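/- Let $f\colon\mathbb{R}\to[0,+\infty)$ be of class $C^2$ with $f(0)=f'(0)=0$, and suppose that there is $\gamma>0$ with $f''(t)\ge\gamma$ for all $t\in\mathbb{R}$. Let $I=(a,b)$ be a bounded open interval, $a<b$, and let $$Y=\{u\in L^2(\mathbb{R}) : u=0 \text{ a.e. in } \mathbb{R}\setminus I\}.$$ For $h>0$ and $u\in Y$ put $$E_h(u)=\frac1{h^2}\int_{\mathbb{R}}\Big[f(u(x))-f\Big(\frac1h\int_x^{x+h}u(y)\,dy\Big)\Big]dx,$$ where the negative part of the integrand is integrable and the integral may equal $+\infty$. Put $$E_0(u)=\begin{cases}\dfrac1{24}\displaystyle\int_{\mathbb{R}}f''(u(x))\,|u'(x)|^2\,dx&\text{if }u\in Y\cap H^1(\mathbb{R}),\\ +\infty&\text{otherwise,}\end{cases}$$ where $u'$ is the weak derivative. Then the functionals $E_h$, restricted to $Y$, $\Gamma$-converge as $h\searrow0$ to $E_0$ with respect to the $L^2(\mathbb{R})$-topology; that is, for every $u\in Y$: 1. for every family $\{u_h\}_{h>0}\subset Y$ with $u_h\to u$ in $L^2(\mathbb{R})$ as $h\searrow0$, one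 has $E_0(u)\le\liminf_{h\searrow0}E_h(u_h)$; 2. there is a family $\{u_h\}_{h>0}\subset Y$ with $u_h\to u$ in $L^2(\mathbb{R})$ as $h\searrow0$ and $\limsup_{h\searrow0}E_h(u_h)\le E_0(u)$. -/

import Mathlib

open MeasureTheory Filter Topology Set

noncomputable section

namespace FiniteDifference

/-- The Hilbert space `L²(ℝ)` of real-valued functions, with Lebesgue measure. -/
abbrev L2R : Type := Lp ℝ 2 (volume : Measure ℝ)

/-- The subspace `Y = {u ∈ L²(ℝ) : u = 0 a.e. in ℝ \ (a, b)}`. -/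
def supportedOn (a b : ℝ) : Submodule ℝ L2R where
  carrier := {u | ∀ᵐ x : ℝ, x ∉ Ioo a b → u x = 0}
  zero_mem' := by
    filter_upwards [Lp.coeFn_zero ℝ 2 (volume : Measure ℝ)] with x hx _
    exact hx
  add_mem' := by
    intro u v hu hv
    filter_upwards [hu, hv, Lp.coeFn_add u v] with x h1 h2 h3 hx
    rw [h3, Pi.add_apply, h1 hx, h2 hx, add_zero]
  smul_mem' := by
    intro c u hu
    filter_upwards [hu, Lp.coeFn_smul c u] with x h1 h2 hx
    rw [h2, Pi.smul_apply, h1 hx, smul_zero]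

/-- The Lebesgue integral over `ℝ` of a function whose negative part is integrable, as an extended
real number: the integral of the positive part minus the integral of the negative part. -/
def extIntegral (g : ℝ → ℝ) : EReal :=
  ((∫⁻ x, ENNReal.ofReal (g x) : ENNReal) : EReal) -
    ((∫⁻ x, ENNReal.ofReal (-g x) : ENNReal) : EReal)

/-- The energy `E_h(u) = h⁻² ∫ [f(u(x)) - f(⨍_{x}^{x+h} u)] dx`.  It is used for `h > 0`, `f`
continuous, nonnegative with `f 0 = 0`, and `u` in `supportedOn a b`; then `⨍_{x}^{x+h} u` is a
bounded function of `x` that vanishes off `(a - h, b)`, so the integrand has an integrable negative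
part, whereas its positive part may have integral `+∞`. -/
def energy (f : ℝ → ℝ) (h : ℝ) (u : L2R) : EReal :=
  (((h ^ 2)⁻¹ : ℝ) : EReal) * extIntegral (fun x => f (u x) - f (⨍ y in x..(x + h), u y))

/-- `v ∈ L²(ℝ)` is the weak (distributional) derivative of `u ∈ L²(ℝ)`. -/
def HasWeakDeriv (u v : L2R) : Prop :=
  ∀ φ : ℝ → ℝ, ContDiff ℝ (⊤ : ℕ∞) φ → HasCompactSupport φ →
    ∫ x, u x * deriv φ x = -∫ x, v x * φ x

/-- `u ∈ H¹(ℝ)`: the weak derivative of `u ∈ L²(ℝ)` exists in `L²(ℝ)`. -/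
def MemH1 (u : L2R) : Prop := ∃ v : L2R, HasWeakDeriv u v

/-- Weak derivatives are unique, so that `u'` below does not depend on any choice. -/
theorem HasWeakDeriv.unique {u v w : L2R} (hv : HasWeakDeriv u v) (hw : HasWeakDeriv u w) :
    v = w := by
  have hloc : ∀ z : L2R, LocallyIntegrable z (volume : Measure ℝ) := fun z =>
    (Lp.memLp z).locallyIntegrable (by norm_num)
  have h : ∀ᵐ x : ℝ, v x = w x := by
    refine ae_eq_of_integral_contDiff_smul_eq (hloc v) (hloc w) ?_
    intro φ h1 h2
    have h3 := (hv φ h1 h2).symm.trans (hw φ h1 h2)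
    simp only [smul_eq_mul, mul_comm (φ _)]
    linarith
  exact Lp.ext h

/-- The weak derivative `u'` of `u ∈ H¹(ℝ)`. -/
def weakDeriv (u : L2R) (hu : MemH1 u) : L2R := hu.choose

open Classical in
/-- The limit energy: `E₀(u) = (1/24) ∫ f''(u) |u'|²` if `u ∈ Y ∩ H¹(ℝ)`, and `+∞` otherwise. -/
def limitEnergy (f : ℝ → ℝ) (a b : ℝ) (u : L2R) : EReal :=
  if hu : u ∈ supportedOn a b ∧ MemH1 u then
    ((1 / 24 : ℝ) : EReal) * extIntegral (fun x => deriv (deriv f) (u x) * |weakDeriv u hu.2 x| ^ 2)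
  else ⊤

end FiniteDifference

end

/-!
By translation invariance, `∫ f(u)` equals the integral of the means of `f(u)` over the windows
`(x, x + h)`, so `h² E_h(u)` is an integral of Jensen gaps `⨍ f(u) - f(⨍ u)`
(`energy_eq_integral_gap`), unless `f(u)` is not integrable and `E_h(u) = +∞` (`energy_eq_top`).
Gaps are compared with Bregman divergences `bregman f s m = f s - f m - f' m (s - m)`.

*Lower bound.* With `m` the mean of `u` on the window, the gap is the mean of `bregman f (u y) m`.
For a small slope `p`, one has `bregman f s m ≥ p (s - m) - p² / (2c)` for every `s`, where `c` is
the infimum of `f''` near `m` only: far from `m` the uniform bound `f'' ≥ γ` beats the linear term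
(`le_bregman`). The slope `p = ψ(x) (y - x - h / 2)`, with a test function `ψ`, gives a bound for
the energy that is affine in `u` up to the factor `1 / c` (`le_energy`). Along `u_h → u` its
linear part converges to `-(1/12) ∫ u ψ'`, because the adjoint kernel is a difference
quotient of `ψ`, and its quadratic part converges to `(1/24) ∫ ψ² / f''(u)`, because the window
means of `u_h` converge to `u` almost everywhere along a subsequence
(`test_le_of_energy_le`). Since `f'' ≥ γ`, the resulting
inequality bounds the distributional derivative of `u` on `L²`, so `u ∈ H¹`; taking the supremum
over `ψ`, whose formal maximiser is `f''(u) u'`, yields the limit energy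
(`limitEnergy_le_of_forall_test`). No compactness of `u_h` beyond `L²` convergence is needed.

*Upper bound.* The constant family `u_h = u` is a recovery family. If `u ∈ H¹`, it has a continuous
compactly supported representative `U`
(`HasWeakDeriv.exists_continuous_representative`). Replacing the mean by the value at the midpoint
of the window can only increase the mean of the Bregman divergences, and
`bregman f (U (x + τ)) (U x) ≤ (|τ| / 2) ∫ (f''(U) + ε) |u'|²`, the integral being taken between `x`
and `x + τ`, for small `τ`. Integrating in `x` and then averaging `τ² / 2` over `(-h/2, h/2)` gives
exactly `h² / 24` (`integral_gap_le`).
-/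

noncomputable section

namespace FiniteDifference

/-! ### Window means -/

/-- The mean of `w` over the window `(x, x + h]`. -/
def windowMean (h : ℝ) (w : ℝ → ℝ) (x : ℝ) : ℝ := h⁻¹ * ∫ t in Ioc 0 h, w (x + t)

theorem setIntegral_Ioc_comp_add_left {h : ℝ} (hh : 0 < h) (w : ℝ → ℝ) (x : ℝ) :
    ∫ t in Ioc 0 h, w (x + t) = ∫ y in x..(x + h), w y := by
  rw [← intervalIntegral.integral_of_le hh.le, intervalIntegral.integral_comp_add_left, add_zero]

theorem intervalAverage_eq_windowMean {h : ℝ} (hh : 0 < h) (w : ℝ → ℝ) (x : ℝ) :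
    ⨍ y in x..(x + h), w y = windowMean h w x := by
  rw [windowMean, setIntegral_Ioc_comp_add_left hh, interval_average_eq, add_sub_cancel_left,
    smul_eq_mul]

section Fubini

variable {w ψ k : ℝ → ℝ}

theorem integrable_shift_kernel (hw : Integrable w) (hψ : Continuous ψ) {B : ℝ}
    (hB : ∀ x, |ψ x| ≤ B) (hk : Continuous k) (h : ℝ) :
    Integrable (fun z : ℝ × ℝ => ψ z.1 * (k z.2 * w (z.1 + z.2)))
      (volume.prod (volume.restrict (Ioc 0 h))) := by
  have hk' : Integrable k (volume.restrict (Ioc 0 h)) :=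
    (hk.integrableOn_Icc (a := 0) (b := h)).mono_set Ioc_subset_Icc_self
  have h1 := (measurePreserving_add_prod (volume : Measure ℝ)
    (volume.restrict (Ioc 0 h))).integrable_comp_of_integrable (hw.mul_prod hk')
  refine (h1.bdd_mul (c := B) (f := fun z : ℝ × ℝ => ψ z.1)
    (by fun_prop) (Eventually.of_forall fun z => hB z.1)).congr ?_
  refine Eventually.of_forall fun z => ?_
  simp only [Function.comp]
  ring

theorem integrable_kernel (hw : Integrable w) (hψ : Continuous ψ) {B : ℝ}
    (hB : ∀ x, |ψ x| ≤ B) (hk : Continuous k) (h : ℝ) :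
    Integrable (fun z : ℝ × ℝ => w z.1 * (k z.2 * ψ (z.1 - z.2)))
      (volume.prod (volume.restrict (Ioc 0 h))) := by
  have hk' : Integrable k (volume.restrict (Ioc 0 h)) :=
    (hk.integrableOn_Icc (a := 0) (b := h)).mono_set Ioc_subset_Icc_self
  refine ((hw.mul_prod hk').bdd_mul (c := B) (f := fun z : ℝ × ℝ => ψ (z.1 - z.2))
    (by fun_prop) (Eventually.of_forall fun z => hB _)).congr ?_
  refine Eventually.of_forall fun z => ?_
  ring

theorem integrable_mul_setIntegral_shift (hw : Integrable w) (hψ : Continuous ψ) {B : ℝ}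
    (hB : ∀ x, |ψ x| ≤ B) (hk : Continuous k) (h : ℝ) :
    Integrable (fun x => ψ x * ∫ t in Ioc 0 h, k t * w (x + t)) := by
  refine (integrable_shift_kernel hw hψ hB hk h).integral_prod_left.congr ?_
  refine Eventually.of_forall fun x => ?_
  simp only [integral_const_mul]

/-- The adjoint of the operator `w ↦ ∫₀ʰ k(t) w(· + t) dt`. -/
theorem integral_mul_setIntegral_shift (hw : Integrable w) (hψ : Continuous ψ) {B : ℝ}
    (hB : ∀ x, |ψ x| ≤ B) (hk : Continuous k) (h : ℝ) :
    ∫ x, ψ x * ∫ t in Ioc 0 h, k t * w (x + t) =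
      ∫ y, w y * ∫ t in Ioc 0 h, k t * ψ (y - t) := by
  calc ∫ x, ψ x * ∫ t in Ioc 0 h, k t * w (x + t)
      = ∫ x, ∫ t in Ioc 0 h, ψ x * (k t * w (x + t)) := by simp only [integral_const_mul]
    _ = ∫ t in Ioc 0 h, ∫ x, ψ x * (k t * w (x + t)) :=
        integral_integral_swap (integrable_shift_kernel hw hψ hB hk h)
    _ = ∫ t in Ioc 0 h, ∫ y, w y * (k t * ψ (y - t)) := by
        congr 1
        ext t
        rw [← integral_sub_right_eq_self (fun x => ψ x * (k t * w (x + t))) t]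
        simp only [sub_add_cancel]
        congr 1
        ext y
        ring
    _ = ∫ y, ∫ t in Ioc 0 h, w y * (k t * ψ (y - t)) :=
        (integral_integral_swap (integrable_kernel hw hψ hB hk h)).symm
    _ = _ := by simp only [integral_const_mul]

theorem integrable_windowMean (hw : Integrable w) (h : ℝ) : Integrable (windowMean h w) := by
  have := integrable_mul_setIntegral_shift hw (ψ := fun _ => 1) (k := fun _ => 1)
    continuous_const (B := 1) (by simp) continuous_const h
  simp only [one_mul] at this
  exact this.const_mul _

theorem integral_windowMean (hw : Integrable w) {h : ℝ} (hh : 0 < h) :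
    ∫ x, windowMean h w x = ∫ x, w x := by
  have := integral_mul_setIntegral_shift hw (ψ := fun _ => 1) (k := fun _ => 1)
    continuous_const (B := 1) (by simp) continuous_const h
  simp only [one_mul] at this
  simp only [windowMean, integral_const_mul, this]
  simp [integral_mul_const, hh.le]
  field_simp

end Fubini

theorem integrableOn_shift {w : ℝ → ℝ} (hw : Integrable w) (x : ℝ) (s : Set ℝ) :
    IntegrableOn (fun t => w (x + t)) s :=
  (hw.comp_add_left x).integrableOn

theorem continuous_windowMean {w : ℝ → ℝ} (hw : Integrable w) {h : ℝ} (hh : 0 < h) :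
    Continuous (windowMean h w) := by
  have hc : Continuous fun x => ∫ y in (0 : ℝ)..x, w y :=
    intervalIntegral.continuous_primitive (fun _ _ => hw.intervalIntegrable) 0
  have : windowMean h w =
      fun x => h⁻¹ * ((∫ y in (0 : ℝ)..(x + h), w y) - ∫ y in (0 : ℝ)..x, w y) := by
    ext x
    rw [windowMean, setIntegral_Ioc_comp_add_left hh,
      intervalIntegral.integral_interval_sub_left hw.intervalIntegrable hw.intervalIntegrable]
  rw [this]
  fun_prop

theorem windowMean_congr_ae {v w : ℝ → ℝ} (h : ℝ) (hvw : v =ᵐ[volume] w) :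
    windowMean h v = windowMean h w := by
  ext x
  rw [windowMean, windowMean]
  congr 1
  refine integral_congr_ae (ae_restrict_of_ae ?_)
  exact (measurePreserving_add_left volume x).quasiMeasurePreserving.ae hvw

theorem windowMean_eq_zero {w : ℝ → ℝ} {a b h x : ℝ} (hw : ∀ᵐ y : ℝ, y ∉ Ioo a b → w y = 0)
    (hx : x ∉ Icc (a - h) b) : windowMean h w x = 0 := by
  rw [windowMean]
  have : ∀ᵐ t ∂(volume.restrict (Ioc 0 h)), w (x + t) = 0 := by
    rw [ae_restrict_iff' measurableSet_Ioc]
    filter_upwards [(measurePreserving_add_left volume x).quasiMeasurePreserving.ae hw] with t ht h2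
    apply ht
    intro h3
    apply hx
    constructor <;> [linarith [h3.1, h2.2]; linarith [h3.2, h2.1]]
  rw [integral_congr_ae this]
  simp

/-! ### Functions supported in the interval -/

theorem integrable_and_integral_abs_le {a b : ℝ} {u : L2R} (hu : u ∈ supportedOn a b) :
    Integrable u ∧ ∫ x, |u x| ≤ Real.sqrt (b - a) * ‖u‖ := by
  have hL : MemLp u 2 (volume.restrict (Ioo a b)) := (Lp.memLp u).restrict _
  have hI : IntegrableOn u (Ioo a b) := hL.integrable (by norm_num)
  have hz : ∀ᵐ x : ℝ, x ∉ Ioo a b → u x = 0 := hu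
  have hint : Integrable u := by
    refine (hI.integrable_indicator measurableSet_Ioo).congr ?_
    filter_upwards [hz] with x hx
    by_cases h : x ∈ Ioo a b
    · simp [h]
    · simp [h, hx h]
  refine ⟨hint, ?_⟩
  have h1 : ∫ x, |u x| = ∫ x in Ioo a b, |u x| := by
    rw [setIntegral_eq_integral_of_ae_compl_eq_zero]
    filter_upwards [hz] with x hx h
    simp [hx h]
  have h2 : eLpNorm u 1 (volume.restrict (Ioo a b)) ≤
      eLpNorm u 2 (volume.restrict (Ioo a b)) *
        (volume.restrict (Ioo a b)) univ ^ (1 / (1 : ENNReal).toReal - 1 / (2 : ENNReal).toReal) :=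
    eLpNorm_le_eLpNorm_mul_rpow_measure_univ (by norm_num) hL.1
  have h3 : eLpNorm u 2 (volume.restrict (Ioo a b)) ≤ eLpNorm u 2 volume :=
    eLpNorm_restrict_le _ _ _ _
  rw [h1]
  have h4 : ∫ x in Ioo a b, |u x| = (eLpNorm u 1 (volume.restrict (Ioo a b))).toReal := by
    rw [eLpNorm_one_eq_lintegral_enorm, ← integral_norm_eq_lintegral_enorm hL.1]
    rfl
  rw [h4]
  have h5 := h2.trans (mul_le_mul_left h3 _)
  have h6 := ENNReal.toReal_mono (ENNReal.mul_ne_top (Lp.eLpNorm_ne_top u)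
    (ENNReal.rpow_ne_top_of_nonneg (by norm_num) (by simp))) h5
  refine h6.trans (le_of_eq ?_)
  rw [ENNReal.toReal_mul, ← Lp.norm_def, mul_comm]
  congr 1
  simp
  rw [← ENNReal.toReal_rpow]
  rcases le_or_gt a b with h | h
  · rw [ENNReal.toReal_ofReal (by linarith), Real.sqrt_eq_rpow]
    norm_num
  · rw [ENNReal.ofReal_of_nonpos (by linarith), Real.sqrt_eq_zero_of_nonpos (by linarith)]
    norm_num

/-! ### The energy as an integral of Jensen gaps -/

theorem extIntegral_eq_integral {g : ℝ → ℝ} (hg : Integrable g) :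
    extIntegral g = ((∫ x, g x : ℝ) : EReal) := by
  have h1 : ∫⁻ x, ENNReal.ofReal (g x) ≠ ⊤ := hg.lintegral_lt_top.ne
  have h2 : ∫⁻ x, ENNReal.ofReal (-g x) ≠ ⊤ := hg.neg.lintegral_lt_top.ne
  rw [extIntegral, integral_eq_lintegral_pos_part_sub_lintegral_neg_part hg, EReal.coe_sub,
    EReal.coe_ennreal_toReal h1, EReal.coe_ennreal_toReal h2]

theorem extIntegral_of_nonneg {g : ℝ → ℝ} (hg : ∀ x, 0 ≤ g x) :
    extIntegral g = ((∫⁻ x, ENNReal.ofReal (g x) : ENNReal) : EReal) := by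
  have : ∀ x, ENNReal.ofReal (-g x) = 0 := fun x => ENNReal.ofReal_of_nonpos (by linarith [hg x])
  simp [extIntegral, this]

theorem integrable_comp_windowMean {f : ℝ → ℝ} (hf : Continuous f) (hf0 : f 0 = 0) {a b h : ℝ}
    (hh : 0 < h) {u : L2R} (hu : u ∈ supportedOn a b) :
    Integrable fun x => f (windowMean h u x) := by
  refine Continuous.integrable_of_hasCompactSupport
    (hf.comp (continuous_windowMean (integrable_and_integral_abs_le hu).1 hh)) ?_
  refine HasCompactSupport.intro (K := Icc (a - h) b) isCompact_Icc fun x hx => ?_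
  rw [windowMean_eq_zero hu hx, hf0]

theorem energy_eq_extIntegral (f : ℝ → ℝ) {h : ℝ} (hh : 0 < h) (u : L2R) :
    energy f h u =
      (((h ^ 2)⁻¹ : ℝ) : EReal) * extIntegral (fun x => f (u x) - f (windowMean h u x)) := by
  simp only [energy, intervalAverage_eq_windowMean hh]

/-- By translation invariance `∫ f(u)` may be replaced by the integral of the window means of
`f(u)`, so that the energy becomes an integral of Jensen gaps. -/
theorem energy_eq_integral_gap {f : ℝ → ℝ} (hf : Continuous f) (hf0 : f 0 = 0) {a b h : ℝ}
    (hh : 0 < h) {u : L2R} (hu : u ∈ supportedOn a b) (hfu : Integrable fun x => f (u x)) :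
    Integrable (fun x => windowMean h (fun y => f (u y)) x - f (windowMean h u x)) ∧
    energy f h u = (((h ^ 2)⁻¹ *
      ∫ x, (windowMean h (fun y => f (u y)) x - f (windowMean h u x)) : ℝ) : EReal) := by
  have h1 := integrable_comp_windowMean hf hf0 hh hu
  refine ⟨(integrable_windowMean hfu h).sub h1, ?_⟩
  rw [energy_eq_extIntegral f hh, extIntegral_eq_integral
    (g := fun x => f (u x) - f (windowMean h u x)) (hfu.sub h1), integral_sub hfu h1,
    integral_sub (integrable_windowMean hfu h) h1, integral_windowMean hfu hh, EReal.coe_mul]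

theorem energy_eq_top {f : ℝ → ℝ} (hf_nonneg : ∀ t, 0 ≤ f t) (hf : Continuous f) (hf0 : f 0 = 0)
    {a b h : ℝ} (hh : 0 < h) {u : L2R} (hu : u ∈ supportedOn a b)
    (hfu : ¬ Integrable fun x => f (u x)) : energy f h u = ⊤ := by
  have h1 := integrable_comp_windowMean hf hf0 hh hu
  have hm : AEStronglyMeasurable (fun x => f (u x)) volume :=
    hf.comp_aestronglyMeasurable (Lp.aestronglyMeasurable u)
  have htop : ∫⁻ x, ENNReal.ofReal (f (u x)) = ⊤ := by
    by_contra hne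
    exact hfu ((lintegral_ofReal_ne_top_iff_integrable hm
      (Eventually.of_forall fun x => hf_nonneg _)).1 hne)
  have hP : ∫⁻ x, ENNReal.ofReal (f (u x) - f (windowMean h u x)) = ⊤ := by
    by_contra hne
    have hle : ∫⁻ x, ENNReal.ofReal (f (u x)) ≤
        (∫⁻ x, ENNReal.ofReal (f (u x) - f (windowMean h u x))) +
          ∫⁻ x, ENNReal.ofReal (f (windowMean h u x)) := by
      rw [← lintegral_add_right' _ h1.1.aemeasurable.ennreal_ofReal]
      refine lintegral_mono fun x => ?_
      refine le_trans (le_of_eq ?_) ENNReal.ofReal_add_le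
      rw [sub_add_cancel]
    rw [htop, top_le_iff] at hle
    exact (ENNReal.add_lt_top.2 ⟨lt_top_iff_ne_top.2 hne, h1.lintegral_lt_top⟩).ne hle
  have hN : ∫⁻ x, ENNReal.ofReal (-(f (u x) - f (windowMean h u x))) ≠ ⊤ := by
    refine ne_top_of_le_ne_top h1.lintegral_lt_top.ne (lintegral_mono fun x => ?_)
    exact ENNReal.ofReal_le_ofReal (by linarith [hf_nonneg (u x)])
  rw [energy_eq_extIntegral f hh, extIntegral, hP, ← EReal.coe_ennreal_toReal hN,
    EReal.coe_ennreal_top, EReal.top_sub_coe, EReal.coe_mul_top_of_pos (by positivity)]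

/-! ### Bregman divergences of a function of class `C²` -/

/-- The Bregman divergence of `f`: the gap between `f s` and the tangent at `m`. -/
def bregman (f : ℝ → ℝ) (s m : ℝ) : ℝ := f s - f m - deriv f m * (s - m)

theorem exists_bregman_eq {f : ℝ → ℝ} (hf : ContDiff ℝ 2 f) (s m : ℝ) :
    ∃ r ∈ uIcc m s, bregman f s m = deriv (deriv f) r / 2 * (s - m) ^ 2 := by
  rcases eq_or_ne m s with rfl | hne
  · exact ⟨m, by simp, by simp [bregman]⟩
  obtain ⟨r, hr, h⟩ := taylor_mean_remainder_lagrange_iteratedDeriv (n := 1) hne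
    (by simpa [one_add_one_eq_two] using hf.contDiffOn)
  refine ⟨r, uIoo_subset_uIcc_self hr, ?_⟩
  have hd : derivWithin f (uIcc m s) m = deriv f m :=
    (hf.differentiable (by norm_num)).differentiableAt.derivWithin
      (uniqueDiffOn_uIcc hne m left_mem_uIcc)
  rw [taylorWithinEval_succ, taylor_within_zero_eval] at h
  simp [iteratedDeriv_succ, iteratedDerivWithin_one, hd] at h
  rw [bregman]
  linarith

theorem bregman_nonneg {f : ℝ → ℝ} (hf : ContDiff ℝ 2 f) (hc : ∀ t, 0 ≤ deriv (deriv f) t)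
    (s m : ℝ) : 0 ≤ bregman f s m := by
  obtain ⟨r, -, h⟩ := exists_bregman_eq hf s m
  rw [h]
  have := hc r
  positivity

/-! ### The lower bound for the energy -/

theorem continuous_deriv_deriv {f : ℝ → ℝ} (hf : ContDiff ℝ 2 f) : Continuous (deriv (deriv f)) :=
  (hf.iterate_deriv' 0 2).continuous

/-- The infimum of `g` over the interval of radius `δ` around `m`. -/
def lowerEnvelope (g : ℝ → ℝ) (δ m : ℝ) : ℝ := sInf ((fun r => g (m + r)) '' Icc (-δ) δ)

theorem continuous_lowerEnvelope {g : ℝ → ℝ} (hg : Continuous g) (δ : ℝ) :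
    Continuous (lowerEnvelope g δ) :=
  IsCompact.continuous_sInf (f := fun m r => g (m + r)) isCompact_Icc
    (hg.comp (continuous_fst.add continuous_snd))

theorem le_lowerEnvelope {g : ℝ → ℝ} {δ m c : ℝ} (hδ : 0 ≤ δ)
    (h : ∀ s, |s - m| ≤ δ → c ≤ g s) : c ≤ lowerEnvelope g δ m := by
  refine le_csInf ((nonempty_Icc.2 (by linarith)).image _) ?_
  rintro _ ⟨r, hr, rfl⟩
  exact h _ (by rw [add_sub_cancel_left]; exact abs_le.2 hr)

theorem lowerEnvelope_le {g : ℝ → ℝ} {δ m s c : ℝ} (hg : ∀ t, c ≤ g t) (hs : |s - m| ≤ δ) :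
    lowerEnvelope g δ m ≤ g s := by
  refine csInf_le ⟨c, ?_⟩ ⟨s - m, abs_le.1 hs, by simp⟩
  rintro _ ⟨r, -, rfl⟩
  exact hg _

theorem tendsto_lowerEnvelope {g : ℝ → ℝ} (hg : Continuous g) {c : ℝ} (hc : ∀ t, c ≤ g t)
    {ι : Type*} {l : Filter ι} {δ m : ι → ℝ} {t : ℝ} (hδ : ∀ i, 0 ≤ δ i)
    (hδ0 : Tendsto δ l (𝓝 0)) (hm : Tendsto m l (𝓝 t)) :
    Tendsto (fun i => lowerEnvelope g (δ i) (m i)) l (𝓝 (g t)) := by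
  rw [Metric.tendsto_nhds]
  intro ε hε
  obtain ⟨η, hη, hgη⟩ := Metric.continuousAt_iff.1 (hg.continuousAt (x := t)) (ε / 2)
    (by positivity)
  filter_upwards [(Metric.tendsto_nhds.1 hδ0) (η / 2) (by positivity),
    (Metric.tendsto_nhds.1 hm) (η / 2) (by positivity)] with i h1 h2
  rw [Real.dist_eq, sub_zero, abs_of_nonneg (hδ i)] at h1
  rw [Real.dist_eq] at h2
  have h3 : g t - ε / 2 ≤ lowerEnvelope g (δ i) (m i) := by
    refine le_lowerEnvelope (hδ i) fun s hs => ?_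
    have : dist s t < η := by
      rw [Real.dist_eq]
      calc |s - t| ≤ |s - m i| + |m i - t| := abs_sub_le _ _ _
        _ < η := by linarith
    have := hgη this
    rw [Real.dist_eq, abs_lt] at this
    linarith [this.1]
  have h4 : lowerEnvelope g (δ i) (m i) ≤ g t + ε / 2 := by
    refine (lowerEnvelope_le hc (s := m i) (by simpa using hδ i)).trans ?_
    have : dist (m i) t < η := by rw [Real.dist_eq]; linarith
    have := hgη this
    rw [Real.dist_eq, abs_lt] at this
    linarith [this.2]
  rw [Real.dist_eq, abs_lt]
  constructor <;> linarith

/-- Fenchel–Young inequality for the Bregman divergence: for small slopes `p` only the values of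
`f''` near `m` matter, since far from `m` the uniform convexity alone beats the linear term. -/
theorem le_bregman {f : ℝ → ℝ} (hf : ContDiff ℝ 2 f) {γ : ℝ} (hγ : ∀ t, γ ≤ deriv (deriv f) t)
    {c δ p m : ℝ} (hc0 : 0 < c) (hc : ∀ s, |s - m| ≤ δ → c ≤ deriv (deriv f) s)
    (hp : |p| ≤ γ * δ / 2) (hγ0 : 0 < γ) (s : ℝ) :
    p * (s - m) - p ^ 2 / (2 * c) ≤ bregman f s m := by
  obtain ⟨r, hr, h⟩ := exists_bregman_eq hf s m
  rw [h]
  rcases le_or_gt |s - m| δ with hs | hs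
  · have h1 : c ≤ deriv (deriv f) r := hc r ((abs_sub_left_of_mem_uIcc hr).trans hs)
    have h2 : c / 2 * (s - m) ^ 2 ≤ deriv (deriv f) r / 2 * (s - m) ^ 2 := by gcongr
    have h3 : c / 2 * (s - m) ^ 2 - (p * (s - m) - p ^ 2 / (2 * c)) =
        (c * (s - m) - p) ^ 2 / (2 * c) := by
      field_simp
      ring
    have h4 : 0 ≤ (c * (s - m) - p) ^ 2 / (2 * c) := by positivity
    linarith
  · have h1 : γ / 2 * (s - m) ^ 2 ≤ deriv (deriv f) r / 2 * (s - m) ^ 2 := by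
      gcongr
      exact hγ r
    have h2 : p * (s - m) ≤ |p| * |s - m| := by rw [← abs_mul]; exact le_abs_self _
    have h3 : |p| * |s - m| ≤ γ / 2 * |s - m| * |s - m| := by
      gcongr
      nlinarith
    have h4 : 0 ≤ p ^ 2 / (2 * c) := by positivity
    have h5 : |s - m| * |s - m| = (s - m) ^ 2 := by rw [← sq, sq_abs]
    nlinarith

theorem setIntegral_Ioc_sub_half {h : ℝ} (hh : 0 < h) : ∫ t in Ioc 0 h, (t - h / 2) = 0 := by
  rw [← intervalIntegral.integral_of_le hh.le]
  simp
  ring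

theorem setIntegral_Ioc_sub_half_sq {h : ℝ} (hh : 0 < h) :
    ∫ t in Ioc 0 h, (t - h / 2) ^ 2 = h ^ 3 / 12 := by
  rw [← intervalIntegral.integral_of_le hh.le,
    intervalIntegral.integral_comp_sub_right (fun t => t ^ 2), integral_pow]
  norm_num
  ring

theorem integrableOn_mul_shift {w k : ℝ → ℝ} (hw : Integrable w) (hk : Continuous k) (x h : ℝ) :
    IntegrableOn (fun t => k t * w (x + t)) (Ioc 0 h) := by
  have := (integrableOn_shift hw x (Icc 0 h)).continuousOn_mul hk.continuousOn isCompact_Icc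
  exact this.mono_set Ioc_subset_Icc_self

/-- The pointwise lower bound for the Jensen gap, obtained from `le_bregman` with the affine slope
`t ↦ q (t - h / 2)`. -/
theorem le_gap {f : ℝ → ℝ} (hf : ContDiff ℝ 2 f) {γ : ℝ} (hγ : ∀ t, γ ≤ deriv (deriv f) t)
    (hγ0 : 0 < γ) {u : ℝ → ℝ} (hu : Integrable u) (hfu : Integrable fun x => f (u x)) {h : ℝ}
    (hh : 0 < h) {B q : ℝ} (hq : |q| ≤ B) (x : ℝ) :
    q * (h⁻¹ * ∫ t in Ioc 0 h, (t - h / 2) * u (x + t)) -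
        h ^ 2 / 24 * (q ^ 2 / lowerEnvelope (deriv (deriv f)) (h * B / γ) (windowMean h u x)) ≤
      windowMean h (fun y => f (u y)) x - f (windowMean h u x) := by
  set m := windowMean h u x with hm
  set c := lowerEnvelope (deriv (deriv f)) (h * B / γ) m with hc
  have hB : 0 ≤ B := (abs_nonneg q).trans hq
  have hc0 : 0 < c := hγ0.trans_le (le_lowerEnvelope (by positivity) fun s _ => hγ s)
  have hpt : ∀ t ∈ Ioc 0 h, q * ((t - h / 2) * u (x + t)) - q * m * (t - h / 2)
      - q ^ 2 / (2 * c) * (t - h / 2) ^ 2 ≤ f (u (x + t)) - deriv f m * u (x + t)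
        - (f m - deriv f m * m) := by
    intro t ht
    have h1 : |q * (t - h / 2)| ≤ γ * (h * B / γ) / 2 := by
      have h2 : |t - h / 2| ≤ h / 2 := abs_le.2 ⟨by linarith [ht.1], by linarith [ht.2]⟩
      rw [abs_mul]
      calc |q| * |t - h / 2| ≤ B * (h / 2) := by gcongr
        _ = _ := by field_simp
    have h3 := le_bregman hf hγ hc0 (fun s hs => lowerEnvelope_le hγ hs) h1 hγ0 (u (x + t))
    rw [bregman] at h3
    have h4 : (q * (t - h / 2)) ^ 2 / (2 * c) = q ^ 2 / (2 * c) * (t - h / 2) ^ 2 := by ring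
    rw [h4] at h3
    linarith
  have i1 : IntegrableOn (fun t => q * ((t - h / 2) * u (x + t))) (Ioc 0 h) :=
    (integrableOn_mul_shift hu (by fun_prop) x h).const_mul q
  have i2 : IntegrableOn (fun t => q * m * (t - h / 2)) (Ioc 0 h) :=
    (Continuous.integrableOn_Icc (by fun_prop)).mono_set Ioc_subset_Icc_self
  have i3 : IntegrableOn (fun t => q ^ 2 / (2 * c) * (t - h / 2) ^ 2) (Ioc 0 h) :=
    (Continuous.integrableOn_Icc (by fun_prop)).mono_set Ioc_subset_Icc_self
  have i4 : IntegrableOn (fun t => f (u (x + t))) (Ioc 0 h) := integrableOn_shift hfu x _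
  have i5 : IntegrableOn (fun t => deriv f m * u (x + t)) (Ioc 0 h) :=
    (integrableOn_shift hu x _).const_mul _
  have i6 : IntegrableOn (fun _ : ℝ => f m - deriv f m * m) (Ioc 0 h) :=
    integrableOn_const (by simp)
  have i12 : IntegrableOn (fun t => q * ((t - h / 2) * u (x + t)) - q * m * (t - h / 2))
      (Ioc 0 h) := i1.sub i2
  have i45 : IntegrableOn (fun t => f (u (x + t)) - deriv f m * u (x + t)) (Ioc 0 h) := i4.sub i5
  have hint := setIntegral_mono_on (i12.sub i3) (i45.sub i6) measurableSet_Ioc hpt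
  have e1 : ∫ t in Ioc 0 h, (q * ((t - h / 2) * u (x + t)) - q * m * (t - h / 2)
      - q ^ 2 / (2 * c) * (t - h / 2) ^ 2) =
      q * (∫ t in Ioc 0 h, (t - h / 2) * u (x + t)) - q ^ 2 / (2 * c) * (h ^ 3 / 12) := by
    rw [integral_sub i12 i3, integral_sub i1 i2, integral_const_mul, integral_const_mul,
      integral_const_mul, setIntegral_Ioc_sub_half hh, setIntegral_Ioc_sub_half_sq hh]
    ring
  have e3 : ∫ t in Ioc 0 h, u (x + t) = h * m := by
    rw [hm, windowMean]
    field_simp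
  have e2 : ∫ t in Ioc 0 h, (f (u (x + t)) - deriv f m * u (x + t)
        - (f m - deriv f m * m)) = (∫ t in Ioc 0 h, f (u (x + t))) - h * f m := by
    rw [integral_sub i45 i6, integral_sub i4 i5, integral_const_mul, e3]
    simp [hh.le]
    ring
  have hint' := mul_le_mul_of_nonneg_left (e1.symm.trans_le (hint.trans_eq e2))
    (inv_nonneg.2 hh.le)
  have e4 : h⁻¹ * ((∫ t in Ioc 0 h, f (u (x + t))) - h * f m) =
      windowMean h (fun y => f (u y)) x - f m := by
    rw [windowMean, mul_sub, inv_mul_cancel_left₀ hh.ne']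
  rw [← e4]
  refine le_trans (le_of_eq ?_) hint'
  generalize ∫ t in Ioc 0 h, (t - h / 2) * u (x + t) = J
  field_simp
  ring

/-- The adjoint of the window integral against the slope `t ↦ t - h / 2`, applied to `ψ` and divided
by `h³`. Since the slope has mean zero on the window, this is a difference quotient of `ψ`; it
approximates `-ψ' / 12`. -/
def dualQuotient (h : ℝ) (ψ : ℝ → ℝ) (y : ℝ) : ℝ :=
  (h ^ 3)⁻¹ * ∫ t in Ioc 0 h, (t - h / 2) * ψ (y - t)

/-- The integrated form of `le_gap`. If `f(u)` is not integrable, the energy is infinite and there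
is nothing to prove. -/
theorem le_energy {f : ℝ → ℝ} (hf_nonneg : ∀ t, 0 ≤ f t) (hf : ContDiff ℝ 2 f) (hf0 : f 0 = 0)
    {γ : ℝ} (hγ : ∀ t, γ ≤ deriv (deriv f) t) (hγ0 : 0 < γ) {a b h : ℝ} (hh : 0 < h) {u : L2R}
    (hu : u ∈ supportedOn a b) {ψ : ℝ → ℝ} (hψ : Continuous ψ) (hψc : HasCompactSupport ψ) {B : ℝ}
    (hB : ∀ x, |ψ x| ≤ B) :
    (((∫ y, u y * dualQuotient h ψ y) - 1 / 24 * ∫ x, ψ x ^ 2 /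
      lowerEnvelope (deriv (deriv f)) (h * B / γ) (windowMean h u x) : ℝ) : EReal) ≤
      energy f h u := by
  have hui := (integrable_and_integral_abs_le hu).1
  by_cases hfu : Integrable fun x => f (u x)
  swap
  · rw [energy_eq_top hf_nonneg hf.continuous hf0 hh hu hfu]
    exact le_top
  obtain ⟨hgi, hE⟩ := energy_eq_integral_gap hf.continuous hf0 hh hu hfu
  rw [hE, EReal.coe_le_coe_iff]
  have hB0 : 0 ≤ B := (abs_nonneg _).trans (hB 0)
  have hpos : ∀ m, 0 < lowerEnvelope (deriv (deriv f)) (h * B / γ) m := fun m =>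
    hγ0.trans_le (le_lowerEnvelope (by positivity) fun s _ => hγ s)
  have hf2 : Continuous (deriv (deriv f)) := continuous_deriv_deriv hf
  have i1 := integrable_mul_setIntegral_shift hui hψ hB (k := fun t => t - h / 2)
    (by fun_prop) h
  have i2 : Integrable fun x => ψ x ^ 2 /
      lowerEnvelope (deriv (deriv f)) (h * B / γ) (windowMean h u x) := by
    refine Continuous.integrable_of_hasCompactSupport ?_ ?_
    · exact (hψ.pow 2).div ((continuous_lowerEnvelope hf2 _).comp (continuous_windowMean hui hh))
        fun x => (hpos _).ne'
    · refine hψc.mono fun x hx => ?_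
      contrapose! hx
      simp [Function.notMem_support.1 hx]
  have i3 : Integrable fun x => ψ x * (h⁻¹ * ∫ t in Ioc 0 h, (t - h / 2) * u (x + t)) :=
    (i1.const_mul h⁻¹).congr (Eventually.of_forall fun x => by ring)
  have hle := integral_mono (i3.sub (i2.const_mul (h ^ 2 / 24))) hgi
    fun x => le_gap hf hγ hγ0 hui hfu hh (hB x) x
  have e1 : ∫ x, ψ x * (h⁻¹ * ∫ t in Ioc 0 h, (t - h / 2) * u (x + t)) =
      h ^ 2 * ∫ y, u y * dualQuotient h ψ y := by
    have := integral_mul_setIntegral_shift hui hψ hB (k := fun t => t - h / 2)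
      (by fun_prop) h
    simp only [dualQuotient, mul_left_comm _ h⁻¹, mul_left_comm _ (h ^ 3)⁻¹, integral_const_mul]
    rw [this]
    generalize ∫ y, u y * ∫ t in Ioc 0 h, (t - h / 2) * ψ (y - t) = J
    field_simp
  simp only [Pi.sub_apply] at hle
  rw [integral_sub i3 (i2.const_mul _), integral_const_mul, e1] at hle
  refine le_trans (le_of_eq ?_) (mul_le_mul_of_nonneg_left hle (by positivity))
  field_simp

/-! ### Passing to the limit against a test function -/

theorem exists_abs_le_of_hasCompactSupport {g : ℝ → ℝ} (hg : Continuous g)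
    (hc : HasCompactSupport g) : ∃ B, ∀ x, |g x| ≤ B :=
  hc.exists_bound_of_continuous hg

theorem contDiff_two_of_top {ψ : ℝ → ℝ} (hψ : ContDiff ℝ (⊤ : ℕ∞) ψ) : ContDiff ℝ 2 ψ :=
  mod_cast contDiff_infty.1 hψ 2

theorem exists_abs_dualQuotient_add_le {ψ : ℝ → ℝ} (hψ : ContDiff ℝ 2 ψ)
    (hψc : HasCompactSupport ψ) :
    ∃ K, 0 ≤ K ∧ ∀ h, 0 < h → ∀ y, |dualQuotient h ψ y + deriv ψ y / 12| ≤ K * h := by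
  obtain ⟨B, hB⟩ := exists_abs_le_of_hasCompactSupport (continuous_deriv_deriv hψ) hψc.deriv.deriv
  have hB0 : 0 ≤ B := (abs_nonneg _).trans (hB 0)
  refine ⟨B / 4, by positivity, fun h hh y => ?_⟩
  have hbr : ∀ t, ψ (y - t) = ψ y - t * deriv ψ y + bregman ψ (y - t) y := by
    intro t
    rw [bregman]
    ring
  have hbc : Continuous fun t => bregman ψ (y - t) y := by
    have := hψ.continuous
    unfold bregman
    fun_prop
  have i1 : IntegrableOn (fun t => (t - h / 2) * (ψ y - t * deriv ψ y)) (Ioc 0 h) :=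
    (Continuous.integrableOn_Icc (by fun_prop)).mono_set Ioc_subset_Icc_self
  have i2 : IntegrableOn (fun t => (t - h / 2) * bregman ψ (y - t) y) (Ioc 0 h) :=
    (Continuous.integrableOn_Icc (by fun_prop)).mono_set Ioc_subset_Icc_self
  have e1 : ∫ t in Ioc 0 h, (t - h / 2) * (ψ y - t * deriv ψ y) = -(h ^ 3 / 12 * deriv ψ y) := by
    have j1 : IntegrableOn (fun t => (ψ y - h / 2 * deriv ψ y) * (t - h / 2)) (Ioc 0 h) :=
      (Continuous.integrableOn_Icc (by fun_prop)).mono_set Ioc_subset_Icc_self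
    have j2 : IntegrableOn (fun t => deriv ψ y * (t - h / 2) ^ 2) (Ioc 0 h) :=
      (Continuous.integrableOn_Icc (by fun_prop)).mono_set Ioc_subset_Icc_self
    have : ∀ t, (t - h / 2) * (ψ y - t * deriv ψ y) =
        (ψ y - h / 2 * deriv ψ y) * (t - h / 2) - deriv ψ y * (t - h / 2) ^ 2 := by
      intro t
      ring
    simp only [this]
    rw [integral_sub j1 j2, integral_const_mul, integral_const_mul, setIntegral_Ioc_sub_half hh,
      setIntegral_Ioc_sub_half_sq hh]
    ring
  have e2 : ∫ t in Ioc 0 h, (t - h / 2) * ψ (y - t) =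
      -(h ^ 3 / 12 * deriv ψ y) + ∫ t in Ioc 0 h, (t - h / 2) * bregman ψ (y - t) y := by
    rw [← e1, ← integral_add i1 i2]
    congr 1
    ext t
    rw [hbr t]
    ring
  have e3 : |∫ t in Ioc 0 h, (t - h / 2) * bregman ψ (y - t) y| ≤ B / 4 * h ^ 3 * h := by
    have := norm_setIntegral_le_of_norm_le_const (μ := volume) (s := Ioc 0 h)
      (f := fun t => (t - h / 2) * bregman ψ (y - t) y) (C := h / 2 * (B / 2 * h ^ 2)) (by simp) ?_
    · simp only [Real.norm_eq_abs, measureReal_def, Real.volume_Ioc, sub_zero,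
        ENNReal.toReal_ofReal hh.le] at this
      refine this.trans (le_of_eq ?_)
      ring
    · intro t ht
      obtain ⟨r, -, hr⟩ := exists_bregman_eq hψ (y - t) y
      rw [Real.norm_eq_abs, abs_mul, hr, abs_mul, abs_div, abs_two, abs_pow, sub_sub_cancel_left,
        abs_neg, abs_of_nonneg ht.1.le]
      have h1 : |t - h / 2| ≤ h / 2 := abs_le.2 ⟨by linarith [ht.1], by linarith [ht.2]⟩
      have h2 := ht.2
      have h3 := hB r
      have h4 := ht.1.le
      gcongr
  have e4 : dualQuotient h ψ y + deriv ψ y / 12 =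
      (h ^ 3)⁻¹ * ∫ t in Ioc 0 h, (t - h / 2) * bregman ψ (y - t) y := by
    rw [dualQuotient, e2]
    generalize ∫ t in Ioc 0 h, (t - h / 2) * bregman ψ (y - t) y = J
    field_simp
    ring
  rw [e4, abs_mul, abs_of_pos (by positivity : (0 : ℝ) < (h ^ 3)⁻¹),
    inv_mul_le_iff₀ (by positivity)]
  refine e3.trans (le_of_eq ?_)
  ring

theorem abs_integral_mul_le {a b : ℝ} {u : L2R} (hu : u ∈ supportedOn a b) {g : ℝ → ℝ} {C : ℝ}
    (hC : ∀ x, |g x| ≤ C) : |∫ x, u x * g x| ≤ C * (Real.sqrt (b - a) * ‖u‖) := by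
  obtain ⟨h1, h2⟩ := integrable_and_integral_abs_le hu
  have hC0 : 0 ≤ C := (abs_nonneg _).trans (hC 0)
  have := norm_integral_le_of_norm_le (f := fun x => u x * g x) (h1.abs.const_mul C)
    (Eventually.of_forall fun x => by
      rw [Real.norm_eq_abs, abs_mul, mul_comm]
      gcongr
      exact hC x)
  rw [integral_const_mul] at this
  exact this.trans (by gcongr)

theorem tendsto_integral_mul_dualQuotient {a b : ℝ} {u : L2R} (hu : u ∈ supportedOn a b)
    {h : ℕ → ℝ} (hh : ∀ n, 0 < h n) (hh0 : Tendsto h atTop (𝓝 0)) {v : ℕ → L2R}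
    (hv : ∀ n, v n ∈ supportedOn a b) (hvu : Tendsto v atTop (𝓝 u)) {ψ : ℝ → ℝ}
    (hψ : ContDiff ℝ 2 ψ) (hψc : HasCompactSupport ψ) :
    Tendsto (fun n => ∫ y, v n y * dualQuotient (h n) ψ y) atTop
      (𝓝 (-(1 / 12) * ∫ y, u y * deriv ψ y)) := by
  obtain ⟨K, hK0, hK⟩ := exists_abs_dualQuotient_add_le hψ hψc
  obtain ⟨B, hB⟩ := exists_abs_le_of_hasCompactSupport hψ.continuous hψc
  have hdc : Continuous (deriv ψ) := hψ.continuous_deriv (by norm_num)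
  obtain ⟨B', hB'⟩ := exists_abs_le_of_hasCompactSupport hdc hψc.deriv
  have hint : ∀ w ∈ supportedOn a b, Integrable fun y => w y * deriv ψ y := fun w hw =>
    (integrable_and_integral_abs_le hw).1.mul_bdd (c := B') hdc.aestronglyMeasurable
      (Eventually.of_forall hB')
  have hsplit : ∀ n, ∫ y, v n y * dualQuotient (h n) ψ y =
      (∫ y, v n y * (dualQuotient (h n) ψ y + deriv ψ y / 12)) -
        1 / 12 * (∫ y, (v n - u) y * deriv ψ y) - 1 / 12 * ∫ y, u y * deriv ψ y := by
    intro n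
    have i1 : Integrable fun y => v n y * dualQuotient (h n) ψ y := by
      have := (integrable_kernel (integrable_and_integral_abs_le (hv n)).1 hψ.continuous hB
        (k := fun t => t - h n / 2) (by fun_prop) (h n)).integral_prod_left.const_mul (h n ^ 3)⁻¹
      refine this.congr (Eventually.of_forall fun y => ?_)
      simp only [integral_const_mul, dualQuotient]
      ring
    have e1 : ∫ y, (v n - u) y * deriv ψ y =
        (∫ y, v n y * deriv ψ y) - ∫ y, u y * deriv ψ y := by
      rw [← integral_sub (hint _ (hv n)) (hint _ hu)]
      refine integral_congr_ae ?_
      filter_upwards [Lp.coeFn_sub (v n) u] with y hy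
      rw [hy, Pi.sub_apply, sub_mul]
    have e2 : ∫ y, v n y * (dualQuotient (h n) ψ y + deriv ψ y / 12) =
        (∫ y, v n y * dualQuotient (h n) ψ y) + 1 / 12 * ∫ y, v n y * deriv ψ y := by
      rw [← integral_const_mul, ← integral_add i1 ((hint _ (hv n)).const_mul _)]
      congr 1
      ext y
      ring
    rw [e1, e2]
    ring
  have hnorm : Tendsto (fun n => ‖v n‖) atTop (𝓝 ‖u‖) := hvu.norm
  have t1 : Tendsto (fun n => ∫ y, v n y * (dualQuotient (h n) ψ y + deriv ψ y / 12)) atTop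
      (𝓝 0) := by
    refine squeeze_zero_norm (a := fun n => K * h n * (Real.sqrt (b - a) * ‖v n‖))
      (fun n => abs_integral_mul_le (hv n) (hK (h n) (hh n))) ?_
    simpa using (hh0.const_mul K).mul (hnorm.const_mul (Real.sqrt (b - a)))
  have t2 : Tendsto (fun n => ∫ y, (v n - u) y * deriv ψ y) atTop (𝓝 0) := by
    refine squeeze_zero_norm (a := fun n => B' * (Real.sqrt (b - a) * ‖v n - u‖))
      (fun n => abs_integral_mul_le ((supportedOn a b).sub_mem (hv n) hu) hB') ?_
    have := (tendsto_iff_norm_sub_tendsto_zero.1 hvu).const_mul (Real.sqrt (b - a))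
    simpa using this.const_mul B'
  simp only [hsplit]
  convert (t1.sub (t2.const_mul (1 / 12))).sub_const (1 / 12 * ∫ y, u y * deriv ψ y) using 2
  simp

theorem integral_abs_windowMean_le {w : ℝ → ℝ} (hw : Integrable w) {h : ℝ} (hh : 0 < h) :
    ∫ x, |windowMean h w x| ≤ ∫ x, |w x| := by
  rw [← integral_windowMean hw.abs hh]
  refine integral_mono (integrable_windowMean hw h).abs (integrable_windowMean hw.abs h) fun x => ?_
  simp only [windowMean, abs_mul, abs_of_pos (inv_pos.2 hh)]
  gcongr
  exact abs_integral_le_integral_abs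

theorem ae_tendsto_windowMean {w : ℝ → ℝ} (hw : Integrable w) {h : ℕ → ℝ} (hh : ∀ n, 0 < h n)
    (hh0 : Tendsto h atTop (𝓝 0)) :
    ∀ᵐ x, Tendsto (fun n => windowMean (h n) w x) atTop (𝓝 (w x)) := by
  filter_upwards [LocallyIntegrable.ae_hasDerivAt_integral hw.locallyIntegrable] with x hx
  have h1 := hasDerivAt_iff_tendsto_slope_zero.1 (hx x)
  have h2 : Tendsto h atTop (𝓝[≠] 0) := tendsto_nhdsWithin_iff.2
    ⟨hh0, Eventually.of_forall fun n => (hh n).ne'⟩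
  refine (h1.comp h2).congr fun n => ?_
  simp [windowMean, setIntegral_Ioc_comp_add_left (hh n)]

theorem windowMean_sub {v w : ℝ → ℝ} (hv : Integrable v) (hw : Integrable w) (h x : ℝ) :
    windowMean h (fun y => v y - w y) x = windowMean h v x - windowMean h w x := by
  rw [windowMean, integral_sub (integrableOn_shift hv x _) (integrableOn_shift hw x _), mul_sub]
  rfl

theorem exists_subseq_ae_tendsto_windowMean {a b : ℝ} {u : L2R} (hu : u ∈ supportedOn a b)
    {h : ℕ → ℝ} (hh : ∀ n, 0 < h n) (hh0 : Tendsto h atTop (𝓝 0)) {v : ℕ → L2R}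
    (hv : ∀ n, v n ∈ supportedOn a b) (hvu : Tendsto v atTop (𝓝 u)) :
    ∃ ns : ℕ → ℕ, StrictMono ns ∧
      ∀ᵐ x, Tendsto (fun n => windowMean (h (ns n)) (v (ns n)) x) atTop (𝓝 (u x)) := by
  have hui := (integrable_and_integral_abs_le hu).1
  have hvi := fun n => (integrable_and_integral_abs_le (hv n)).1
  have hi : ∀ n, Integrable fun y => v n y - u y := fun n => (hvi n).sub hui
  have hL1 : Tendsto (fun n => eLpNorm (windowMean (h n) (fun y => v n y - u y)) 1 volume) atTop
      (𝓝 0) := by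
    have hb : ∀ n, eLpNorm (windowMean (h n) (fun y => v n y - u y)) 1 volume ≤
        ENNReal.ofReal (Real.sqrt (b - a) * ‖v n - u‖) := by
      intro n
      rw [eLpNorm_one_eq_lintegral_enorm,
        ← ofReal_integral_norm_eq_lintegral_enorm (integrable_windowMean (hi n) _)]
      refine ENNReal.ofReal_le_ofReal ((integral_abs_windowMean_le (hi n) (hh n)).trans ?_)
      refine le_trans (le_of_eq ?_)
        (integrable_and_integral_abs_le ((supportedOn a b).sub_mem (hv n) hu)).2
      refine integral_congr_ae ?_
      filter_upwards [Lp.coeFn_sub (v n) u] with y hy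
      rw [hy, Pi.sub_apply]
    refine tendsto_of_tendsto_of_tendsto_of_le_of_le tendsto_const_nhds ?_ (fun _ => zero_le) hb
    have := (tendsto_iff_norm_sub_tendsto_zero.1 hvu).const_mul (Real.sqrt (b - a))
    simpa using ENNReal.tendsto_ofReal this
  have hmeas := tendstoInMeasure_of_tendsto_eLpNorm (g := 0) one_ne_zero
    (fun n => (integrable_windowMean (hi n) (h n)).1) aestronglyMeasurable_zero
    (by simpa using hL1)
  obtain ⟨ns, hns, hae⟩ := hmeas.exists_seq_tendsto_ae
  refine ⟨ns, hns, ?_⟩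
  filter_upwards [hae, ae_tendsto_windowMean hui (fun n => hh (ns n))
    (hh0.comp hns.tendsto_atTop)] with x h1 h2
  have := h1.add h2
  simpa [windowMean_sub (hvi _) hui] using this

/-- The limit of the lower bound `le_energy`, as `h → 0`. -/
theorem test_le_of_energy_le {f : ℝ → ℝ} (hf_nonneg : ∀ t, 0 ≤ f t) (hf : ContDiff ℝ 2 f)
    (hf0 : f 0 = 0) {γ : ℝ} (hγ : ∀ t, γ ≤ deriv (deriv f) t) (hγ0 : 0 < γ) {a b : ℝ} {u : L2R}
    (hu : u ∈ supportedOn a b) {h : ℕ → ℝ} (hh : ∀ n, 0 < h n) (hh0 : Tendsto h atTop (𝓝 0))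
    {v : ℕ → L2R} (hv : ∀ n, v n ∈ supportedOn a b) (hvu : Tendsto v atTop (𝓝 u)) {M : ℝ}
    (hM : ∀ n, energy f (h n) (v n) ≤ M) {ψ : ℝ → ℝ} (hψ : ContDiff ℝ 2 ψ)
    (hψc : HasCompactSupport ψ) :
    -(1 / 12) * (∫ y, u y * deriv ψ y) - 1 / 24 * ∫ x, ψ x ^ 2 / deriv (deriv f) (u x) ≤ M := by
  obtain ⟨ns, hns, hae⟩ := exists_subseq_ae_tendsto_windowMean hu hh hh0 hv hvu
  obtain ⟨B, hB⟩ := exists_abs_le_of_hasCompactSupport hψ.continuous hψc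
  have hB0 : 0 ≤ B := (abs_nonneg _).trans (hB 0)
  have hf2 := continuous_deriv_deriv hf
  have hγe : ∀ n m, γ ≤ lowerEnvelope (deriv (deriv f)) (h n * B / γ) m := fun n m =>
    le_lowerEnvelope (by have := hh n; positivity) fun s _ => hγ s
  have t1 := (tendsto_integral_mul_dualQuotient hu hh hh0 hv hvu hψ hψc).comp hns.tendsto_atTop
  have t2 : Tendsto (fun n => ∫ x, ψ x ^ 2 / lowerEnvelope (deriv (deriv f)) (h (ns n) * B / γ)
      (windowMean (h (ns n)) (v (ns n)) x)) atTop
      (𝓝 (∫ x, ψ x ^ 2 / deriv (deriv f) (u x))) := by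
    refine tendsto_integral_of_dominated_convergence (fun x => ψ x ^ 2 / γ) ?_ ?_ ?_ ?_
    · intro n
      refine Continuous.aestronglyMeasurable ((hψ.continuous.pow 2).div
        ((continuous_lowerEnvelope hf2 _).comp (continuous_windowMean
          (integrable_and_integral_abs_le (hv _)).1 (hh _)))
        fun x => (hγ0.trans_le (hγe _ _)).ne')
    · refine Continuous.integrable_of_hasCompactSupport
        ((hψ.continuous.pow 2).div_const γ) (hψc.mono fun x hx => ?_)
      contrapose! hx
      simp [Function.notMem_support.1 hx]
    · refine fun n => Eventually.of_forall fun x => ?_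
      have := hγe (ns n) (windowMean (h (ns n)) (v (ns n)) x)
      rw [Real.norm_eq_abs, abs_of_nonneg (div_nonneg (sq_nonneg _) (hγ0.le.trans this))]
      gcongr
    · filter_upwards [hae] with x hx
      refine tendsto_const_nhds.div (tendsto_lowerEnvelope hf2 hγ (fun n => ?_) ?_ hx)
        (hγ0.trans_le (hγ _)).ne'
      · have := hh (ns n)
        positivity
      · simpa using ((hh0.comp hns.tendsto_atTop).mul_const B).div_const γ
  refine le_of_tendsto' (t1.sub (t2.const_mul (1 / 24))) fun n => ?_
  have := (le_energy hf_nonneg hf hf0 hγ hγ0 (hh (ns n)) (hv (ns n)) hψ.continuous hψc hB).trans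
    (hM (ns n))
  exact EReal.coe_le_coe_iff.1 this

/-! ### Weak derivatives by duality -/

/-- The space of test functions: smooth functions with compact support. -/
def testSpace : Submodule ℝ (ℝ → ℝ) where
  carrier := {φ | ContDiff ℝ (⊤ : ℕ∞) φ ∧ HasCompactSupport φ}
  zero_mem' := ⟨contDiff_const, HasCompactSupport.zero⟩
  add_mem' h1 h2 := ⟨h1.1.add h2.1, h1.2.add h2.2⟩
  smul_mem' c _ h := ⟨h.1.const_smul c, h.2.smul_left (f := fun _ => c)⟩

theorem testSpace.memLp (φ : testSpace) : MemLp (φ : ℝ → ℝ) 2 volume :=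
  φ.2.1.continuous.memLp_of_hasCompactSupport φ.2.2

/-- The inclusion of the test functions in `L²(ℝ)`. -/
def testToL2 : testSpace →ₗ[ℝ] L2R where
  toFun φ := (testSpace.memLp φ).toLp
  map_add' _ _ := rfl
  map_smul' _ _ := rfl

theorem coeFn_testToL2 (φ : testSpace) : testToL2 φ =ᵐ[volume] (φ : ℝ → ℝ) :=
  (testSpace.memLp φ).coeFn_toLp

theorem inner_testToL2 (v : L2R) (φ : testSpace) :
    inner ℝ v (testToL2 φ) = ∫ x, v x * (φ : ℝ → ℝ) x := by
  rw [L2.inner_def]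
  refine integral_congr_ae ?_
  filter_upwards [coeFn_testToL2 φ] with x hx
  simp [hx, mul_comm]

theorem norm_testToL2_sq (φ : testSpace) : ‖testToL2 φ‖ ^ 2 = ∫ x, (φ : ℝ → ℝ) x ^ 2 := by
  rw [← real_inner_self_eq_norm_sq, inner_testToL2]
  refine integral_congr_ae ?_
  filter_upwards [coeFn_testToL2 φ] with x hx
  rw [hx, sq]

theorem denseRange_testToL2 : DenseRange testToL2 := by
  have h : (LinearMap.range testToL2).topologicalClosure = ⊤ := by
    rw [Submodule.topologicalClosure_eq_top_iff, Submodule.eq_bot_iff]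
    intro v hv
    rw [Submodule.mem_orthogonal'] at hv
    refine (Lp.eq_zero_iff_ae_eq_zero).2 ?_
    refine ae_eq_zero_of_integral_contDiff_smul_eq_zero
      ((Lp.memLp v).locallyIntegrable (by norm_num)) fun φ h1 h2 => ?_
    have := hv _ ⟨⟨φ, h1, h2⟩, rfl⟩
    rw [inner_testToL2] at this
    simpa [mul_comm] using this
  intro x
  have : x ∈ (LinearMap.range testToL2).topologicalClosure := by rw [h]; trivial
  rwa [← SetLike.mem_coe, Submodule.topologicalClosure_coe, LinearMap.coe_range] at this

theorem integrable_mul_deriv (u : L2R) (φ : testSpace) :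
    Integrable fun x => u x * deriv (φ : ℝ → ℝ) x :=
  (Lp.memLp u).integrable_mul (((φ.2.1.continuous_deriv (by simp)).memLp_of_hasCompactSupport
    φ.2.2.deriv) : MemLp (deriv (φ : ℝ → ℝ)) 2 volume)

/-- The distributional derivative of `u`, as a linear functional on test functions. -/
def distDeriv (u : L2R) : testSpace →ₗ[ℝ] ℝ where
  toFun φ := -∫ x, u x * deriv (φ : ℝ → ℝ) x
  map_add' φ χ := by
    rw [← neg_add, ← integral_add (integrable_mul_deriv u φ) (integrable_mul_deriv u χ)]
    congr 2
    ext x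
    have h1 : DifferentiableAt ℝ (φ : ℝ → ℝ) x := (φ.2.1.differentiable (by simp)) x
    have h2 : DifferentiableAt ℝ (χ : ℝ → ℝ) x := (χ.2.1.differentiable (by simp)) x
    rw [Submodule.coe_add, deriv_add h1 h2, mul_add]
  map_smul' c φ := by
    rw [RingHom.id_apply, smul_eq_mul, mul_neg, ← integral_const_mul]
    congr 2
    ext x
    have h1 : DifferentiableAt ℝ (φ : ℝ → ℝ) x := (φ.2.1.differentiable (by simp)) x
    rw [Submodule.coe_smul, deriv_const_smul _ h1]
    simp only [smul_eq_mul]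
    ring

/-- A function whose distributional derivative is bounded on test functions by a multiple of the
`L²` norm belongs to `H¹`, by the Riesz representation theorem. -/
theorem memH1_of_bound {u : L2R} {C : ℝ} (hC : ∀ φ, ‖distDeriv u φ‖ ≤ C * ‖testToL2 φ‖) :
    MemH1 u := by
  set F := (distDeriv u).extendOfNorm testToL2
  refine ⟨(InnerProductSpace.toDual ℝ L2R).symm F, fun φ h1 h2 => ?_⟩
  have h3 := LinearMap.extendOfNorm_eq denseRange_testToL2 ⟨C, hC⟩ ⟨φ, h1, h2⟩
  have h4 : inner ℝ ((InnerProductSpace.toDual ℝ L2R).symm F) (testToL2 ⟨φ, h1, h2⟩) =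
      F (testToL2 ⟨φ, h1, h2⟩) := InnerProductSpace.toDual_symm_apply
  rw [inner_testToL2, h3] at h4
  rw [h4]
  simp [distDeriv]

theorem abs_le_of_forall_smul_le {L N A D : ℝ} (hN : 0 ≤ N)
    (h : ∀ s : ℝ, s * L ≤ A + D * (s * N) ^ 2) : |L| ≤ (A + D) * N := by
  rcases hN.eq_or_lt with rfl | hN
  · have : L = 0 := by
      by_contra hL
      have := h ((A + 1) / L)
      rw [div_mul_cancel₀ _ hL] at this
      simp at this
      linarith
    simp [this]
  · have h1 := h N⁻¹
    have h2 := h (-N⁻¹)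
    have e1 : N⁻¹ * N = 1 := inv_mul_cancel₀ hN.ne'
    rw [e1] at h1
    rw [neg_mul, neg_mul, e1] at h2
    rw [abs_le]
    have e2 : L = (N⁻¹ * L) * N := by field_simp
    constructor
    · rw [e2, ← neg_mul]
      gcongr
      linarith
    · rw [e2]
      gcongr
      linarith

theorem memH1_of_forall_test {f : ℝ → ℝ} {γ : ℝ}
    (hγ : ∀ t, γ ≤ deriv (deriv f) t) (hγ0 : 0 < γ) {u : L2R} {M : ℝ}
    (hM : ∀ φ : testSpace, 1 / 12 * distDeriv u φ -
      1 / 24 * (∫ x, (φ : ℝ → ℝ) x ^ 2 / deriv (deriv f) (u x)) ≤ M) :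
    MemH1 u := by
  have hpos : ∀ t, 0 < deriv (deriv f) t := fun t => hγ0.trans_le (hγ t)
  refine memH1_of_bound (C := 12 * M + 1 / (2 * γ)) fun φ => ?_
  refine abs_le_of_forall_smul_le (norm_nonneg _) fun s => ?_
  have h1 := hM (s • φ)
  rw [map_smul, smul_eq_mul] at h1
  have h2 : ∫ x, ((s • φ : testSpace) : ℝ → ℝ) x ^ 2 / deriv (deriv f) (u x) ≤
      1 / γ * (s * ‖testToL2 φ‖) ^ 2 := by
    have e : (s * ‖testToL2 φ‖) ^ 2 = ∫ x, ((s • φ : testSpace) : ℝ → ℝ) x ^ 2 := by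
      rw [mul_pow, norm_testToL2_sq, ← integral_const_mul]
      congr 1
      ext x
      simp [mul_pow]
    rw [e, ← integral_const_mul]
    refine integral_mono_of_nonneg (Eventually.of_forall fun x => ?_) ?_
      (Eventually.of_forall fun x => ?_)
    · exact div_nonneg (sq_nonneg _) (hpos _).le
    · exact ((testSpace.memLp (s • φ)).integrable_sq).const_mul _
    · have := hγ (u x)
      simp only []
      rw [one_div_mul_eq_div]
      gcongr
  have h3 : 1 / (2 * γ) * (s * ‖testToL2 φ‖) ^ 2 =
    (1 / γ * (s * ‖testToL2 φ‖) ^ 2) / 2 := by field_simp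
  rw [h3]
  linarith

/-- The test-function inequality extends to `L²`, since its quadratic part
`g ↦ ∫ g² / f''(u)` is continuous there. -/
theorem inner_sub_integral_le_of_forall_test {f : ℝ → ℝ} (hf : ContDiff ℝ 2 f) {γ : ℝ}
    (hγ : ∀ t, γ ≤ deriv (deriv f) t) (hγ0 : 0 < γ) {u v : L2R} (hv : HasWeakDeriv u v) {M : ℝ}
    (hM : ∀ φ : testSpace, 1 / 12 * distDeriv u φ -
      1 / 24 * (∫ x, (φ : ℝ → ℝ) x ^ 2 / deriv (deriv f) (u x)) ≤ M) (g : L2R) :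
    1 / 12 * inner ℝ v g - 1 / 24 * (∫ x, g x ^ 2 / deriv (deriv f) (u x)) ≤ M := by
  have hpos : ∀ t, 0 < deriv (deriv f) t := fun t => hγ0.trans_le (hγ t)
  have hf2 := continuous_deriv_deriv hf
  have hum : Measurable u := (Lp.stronglyMeasurable u).measurable
  have hfm : Measurable fun x => deriv (deriv f) (u x) := hf2.measurable.comp hum
  have hρ : MemLp (fun x => 1 / deriv (deriv f) (u x)) ⊤ volume := by
    refine memLp_top_of_bound (measurable_const.div hfm).aestronglyMeasurable (1 / γ)
      (Eventually.of_forall fun x => ?_)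
    rw [Real.norm_eq_abs, abs_of_pos (one_div_pos.2 (hpos _))]
    exact one_div_le_one_div_of_le hγ0 (hγ _)
  set T : L2R →L[ℝ] L2R := (ContinuousLinearMap.mul ℝ ℝ).holderL volume ⊤ 2 2 hρ.toLp with hT
  have hTc : ∀ g : L2R, T g =ᵐ[volume] fun x => g x / deriv (deriv f) (u x) := by
    intro g
    filter_upwards [(ContinuousLinearMap.mul ℝ ℝ).coeFn_holder (r := 2) hρ.toLp g,
      hρ.coeFn_toLp] with x h1 h2
    rw [hT, ContinuousLinearMap.holderL_apply_apply, h1, h2]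
    simp [div_eq_inv_mul]
  have hQ : ∀ g : L2R, inner ℝ g (T g) = ∫ x, g x ^ 2 / deriv (deriv f) (u x) := by
    intro g
    rw [L2.inner_def]
    refine integral_congr_ae ?_
    filter_upwards [hTc g] with x hx
    rw [hx]
    simp
    ring
  have hall : ∀ g : L2R, 1 / 12 * inner ℝ v g - 1 / 24 * inner ℝ g (T g) ≤ M := by
    intro g
    refine denseRange_testToL2.induction_on (p := fun g : L2R =>
      1 / 12 * inner ℝ v g - 1 / 24 * inner ℝ g (T g) ≤ M) g ?_ fun φ => ?_
    · exact isClosed_le (by fun_prop) continuous_const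
    · have h1 := hM φ
      have h2 := hv φ φ.2.1 φ.2.2
      rw [inner_testToL2, hQ]
      have h3 : ∫ x, testToL2 φ x ^ 2 / deriv (deriv f) (u x) =
          ∫ x, (φ : ℝ → ℝ) x ^ 2 / deriv (deriv f) (u x) := by
        refine integral_congr_ae ?_
        filter_upwards [coeFn_testToL2 φ] with x hx
        rw [hx]
      rw [h3]
      have h4 : distDeriv u φ = ∫ x, v x * (φ : ℝ → ℝ) x := by
        simp [distDeriv, h2]
      rwa [h4] at h1
  rw [← hQ]
  exact hall g

/-- The optimal choice in `inner_sub_integral_le_of_forall_test` is `g = f''(u) v`, truncated to the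
set where `f''(u) ≤ K` in order to belong to `L²`. -/
theorem integral_indicator_le_of_forall_test {f : ℝ → ℝ} (hf : ContDiff ℝ 2 f) {γ : ℝ}
    (hγ : ∀ t, γ ≤ deriv (deriv f) t) (hγ0 : 0 < γ) {u v : L2R} (hv : HasWeakDeriv u v) {M : ℝ}
    (hM : ∀ φ : testSpace, 1 / 12 * distDeriv u φ -
      1 / 24 * (∫ x, (φ : ℝ → ℝ) x ^ 2 / deriv (deriv f) (u x)) ≤ M) (K : ℕ) :
    Integrable ({x | deriv (deriv f) (u x) ≤ K}.indicator
      fun x => deriv (deriv f) (u x) * v x ^ 2) ∧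
    ∫ x, {x | deriv (deriv f) (u x) ≤ K}.indicator
      (fun x => deriv (deriv f) (u x) * v x ^ 2) x ≤ 24 * M := by
  have hpos : ∀ t, 0 < deriv (deriv f) t := fun t => hγ0.trans_le (hγ t)
  have hf2 := continuous_deriv_deriv hf
  have hum : Measurable u := (Lp.stronglyMeasurable u).measurable
  have hfm : Measurable fun x => deriv (deriv f) (u x) := hf2.measurable.comp hum
  have hall := inner_sub_integral_le_of_forall_test hf hγ hγ0 hv hM
  have hvm : Measurable v := (Lp.stronglyMeasurable v).measurable
  set S : Set ℝ := {x | deriv (deriv f) (u x) ≤ K} with hS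
  have hSm : MeasurableSet S := measurableSet_le hfm measurable_const
  have hg : MemLp (S.indicator fun x => deriv (deriv f) (u x) * v x) 2 volume := by
    refine (Lp.memLp v).of_le_mul (c := K)
      ((hfm.mul hvm).indicator hSm).aestronglyMeasurable (Eventually.of_forall fun x => ?_)
    by_cases hx : x ∈ S
    · rw [indicator_of_mem hx, norm_mul, Real.norm_of_nonneg (hpos _).le]
      gcongr
      exact hx
    · rw [indicator_of_notMem hx, norm_zero]
      positivity
  have h1 := hall hg.toLp
  have e1 : inner ℝ v hg.toLp = ∫ x, S.indicator (fun x => deriv (deriv f) (u x) * v x ^ 2) x := by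
    rw [L2.inner_def]
    refine integral_congr_ae ?_
    filter_upwards [hg.coeFn_toLp] with x hx
    rw [hx]
    by_cases hx : x ∈ S
    · simp only [indicator_of_mem hx, RCLike.inner_apply, conj_trivial]
      ring
    · simp [indicator_of_notMem hx]
  have e2 : ∫ x, (MemLp.toLp _ hg) x ^ 2 / deriv (deriv f) (u x) =
      ∫ x, S.indicator (fun x => deriv (deriv f) (u x) * v x ^ 2) x := by
    refine integral_congr_ae ?_
    filter_upwards [hg.coeFn_toLp] with x hx
    rw [hx]
    by_cases hx : x ∈ S
    · have := (hpos (u x)).ne'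
      simp only [indicator_of_mem hx]
      field_simp
    · simp [indicator_of_notMem hx]
  rw [e1, e2] at h1
  refine ⟨?_, by linarith⟩
  refine ((Lp.memLp v).integrable_mul hg).congr (Eventually.of_forall fun x => ?_)
  by_cases hx : x ∈ S
  · simp only [Pi.mul_apply, indicator_of_mem hx]
    ring
  · simp [indicator_of_notMem hx]

theorem tendsto_lintegral_indicator_le {g w : ℝ → ℝ} (hg : Measurable g) (hw : Measurable w)
    (hw0 : ∀ x, 0 ≤ w x) :
    Tendsto (fun K : ℕ => ∫⁻ x, ENNReal.ofReal ({x | g x ≤ K}.indicator w x)) atTop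
      (𝓝 (∫⁻ x, ENNReal.ofReal (w x))) := by
  refine lintegral_tendsto_of_tendsto_of_monotone (fun K => ?_)
    (Eventually.of_forall fun x K K' hK => ?_) (Eventually.of_forall fun x => ?_)
  · exact (hw.indicator (measurableSet_le hg measurable_const)).ennreal_ofReal.aemeasurable
  · refine ENNReal.ofReal_le_ofReal (indicator_le_indicator_of_subset (fun y hy => ?_) hw0 x)
    exact (show g y ≤ K from hy).trans (Nat.cast_le.2 hK)
  · refine tendsto_const_nhds.congr' ?_
    filter_upwards [eventually_ge_atTop ⌈g x⌉₊] with K hK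
    have : x ∈ {x | g x ≤ K} := (Nat.le_ceil _).trans (Nat.cast_le.2 hK)
    rw [indicator_of_mem this]

/-- The test-function inequality of `test_le_of_energy_le` forces `u ∈ H¹` and bounds the limit
energy. -/
theorem limitEnergy_le_of_forall_test {f : ℝ → ℝ} (hf : ContDiff ℝ 2 f) {γ : ℝ}
    (hγ : ∀ t, γ ≤ deriv (deriv f) t) (hγ0 : 0 < γ) {a b : ℝ} {u : L2R}
    (hu : u ∈ supportedOn a b) {M : ℝ}
    (hM : ∀ φ : testSpace, 1 / 12 * distDeriv u φ -
      1 / 24 * (∫ x, (φ : ℝ → ℝ) x ^ 2 / deriv (deriv f) (u x)) ≤ M) :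
    limitEnergy f a b u ≤ M := by
  have hpos : ∀ t, 0 < deriv (deriv f) t := fun t => hγ0.trans_le (hγ t)
  have hfm : Measurable fun x => deriv (deriv f) (u x) :=
    (continuous_deriv_deriv hf).measurable.comp (Lp.stronglyMeasurable u).measurable
  obtain ⟨v, hv⟩ := memH1_of_forall_test hγ hγ0 hM
  have hnn : ∀ x, 0 ≤ deriv (deriv f) (u x) * v x ^ 2 := fun x =>
    mul_nonneg (hpos _).le (sq_nonneg _)
  have hlin : ∫⁻ x, ENNReal.ofReal (deriv (deriv f) (u x) * v x ^ 2) ≤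
      ENNReal.ofReal (24 * M) := by
    refine le_of_tendsto' (tendsto_lintegral_indicator_le hfm
      (hfm.mul ((Lp.stronglyMeasurable v).measurable.pow_const 2)) hnn) fun K => ?_
    obtain ⟨h1, h2⟩ := integral_indicator_le_of_forall_test hf hγ hγ0 hv hM K
    rw [← ofReal_integral_eq_lintegral_ofReal h1
      (Eventually.of_forall fun x => indicator_nonneg (fun y _ => hnn y) x)]
    exact ENNReal.ofReal_le_ofReal h2
  have hM0 : 0 ≤ M := by simpa using hM 0
  have hw : weakDeriv u ⟨v, hv⟩ = v :=
    HasWeakDeriv.unique (Exists.choose_spec (⟨v, hv⟩ : MemH1 u)) hv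
  rw [limitEnergy, dif_pos ⟨hu, ⟨v, hv⟩⟩, hw]
  simp only [sq_abs]
  rw [extIntegral_of_nonneg hnn]
  have hfin := ne_top_of_le_ne_top ENNReal.ofReal_ne_top hlin
  rw [← EReal.coe_ennreal_toReal hfin, ← EReal.coe_mul, EReal.coe_le_coe_iff]
  have := ENNReal.toReal_le_of_le_ofReal (by positivity) hlin
  linarith

theorem limitEnergy_le_liminf {f : ℝ → ℝ} (hf_nonneg : ∀ t, 0 ≤ f t) (hf : ContDiff ℝ 2 f)
    (hf0 : f 0 = 0) {γ : ℝ} (hγ : ∀ t, γ ≤ deriv (deriv f) t) (hγ0 : 0 < γ) {a b : ℝ} {u : L2R}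
    (hu : u ∈ supportedOn a b) {v : ℝ → L2R} (hv : ∀ h, 0 < h → v h ∈ supportedOn a b)
    (hvu : Tendsto v (𝓝[>] 0) (𝓝 u)) :
    limitEnergy f a b u ≤ liminf (fun h => energy f h (v h)) (𝓝[>] 0) := by
  by_contra hlt
  obtain ⟨M, hM1, hM2⟩ := EReal.lt_iff_exists_real_btwn.1 (not_le.1 hlt)
  have hfreq : ∃ᶠ h in 𝓝[>] (0 : ℝ), energy f h (v h) < M :=
    frequently_lt_of_liminf_lt (by isBoundedDefault) hM1
  obtain ⟨h, hh, hp⟩ := exists_seq_forall_of_frequently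
    (hfreq.and_eventually (eventually_mem_nhdsWithin : ∀ᶠ h in 𝓝[>] (0 : ℝ), h ∈ Ioi 0))
  refine hM2.not_ge (limitEnergy_le_of_forall_test hf hγ hγ0 hu fun φ => ?_)
  have := test_le_of_energy_le hf_nonneg hf hf0 hγ hγ0 hu (fun n => (hp n).2)
    (tendsto_nhds_of_tendsto_nhdsWithin hh) (fun n => hv _ (hp n).2) (hvu.comp hh)
    (fun n => (hp n).1.le) (contDiff_two_of_top φ.2.1) φ.2.2
  simpa [distDeriv] using this

/-! ### The continuous representative of a compactly supported `H¹` function -/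

theorem contDiff_windowIntegral {φ : ℝ → ℝ} (hφ : ContDiff ℝ (⊤ : ℕ∞) φ) {h : ℝ} (hh : 0 < h) :
    ContDiff ℝ (⊤ : ℕ∞) (fun y => ∫ s in Ioc 0 h, φ (y - s)) ∧
    ∀ y, deriv (fun y => ∫ s in Ioc 0 h, φ (y - s)) y = φ y - φ (y - h) := by
  have e : (fun y => ∫ s in Ioc 0 h, φ (y - s)) =
      fun y => (∫ s in (0 : ℝ)..y, φ s) - ∫ s in (0 : ℝ)..(y - h), φ s := by
    ext y
    rw [← intervalIntegral.integral_of_le hh.le, intervalIntegral.integral_comp_sub_left, sub_zero,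
      intervalIntegral.integral_interval_sub_left] <;> exact hφ.continuous.intervalIntegrable _ _
  have hP : ∀ y, HasDerivAt (fun y => ∫ s in (0 : ℝ)..y, φ s) (φ y) y := fun y =>
    intervalIntegral.integral_hasDerivAt_right (hφ.continuous.intervalIntegrable _ _)
      hφ.continuous.aestronglyMeasurable.stronglyMeasurableAtFilter hφ.continuous.continuousAt
  have hd : ∀ y, HasDerivAt (fun y => ∫ s in Ioc 0 h, φ (y - s)) (φ y - φ (y - h)) y := by
    intro y
    rw [e]
    exact (hP y).sub ((hP (y - h)).comp_sub_const y h)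
  refine ⟨?_, fun y => (hd y).deriv⟩
  rw [contDiff_infty_iff_deriv]
  refine ⟨fun y => (hd y).differentiableAt, ?_⟩
  have : deriv (fun y => ∫ s in Ioc 0 h, φ (y - s)) = fun y => φ y - φ (y - h) :=
    funext fun y => (hd y).deriv
  rw [this]
  exact hφ.sub (hφ.comp (contDiff_id.sub contDiff_const))

theorem hasCompactSupport_windowIntegral {φ : ℝ → ℝ} (hφ : HasCompactSupport φ) (h : ℝ) :
    HasCompactSupport (fun y => ∫ s in Ioc 0 h, φ (y - s)) := by
  obtain ⟨R, hR⟩ := hφ.isCompact.isBounded.subset_closedBall 0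
  refine HasCompactSupport.intro (K := Icc (-R) (R + h)) isCompact_Icc fun y hy => ?_
  refine setIntegral_eq_zero_of_forall_eq_zero fun s hs => ?_
  by_contra hne
  have := hR (subset_tsupport φ hne)
  rw [mem_closedBall_zero_iff, Real.norm_eq_abs, abs_le] at this
  exact hy ⟨by linarith [hs.1], by linarith [hs.2]⟩

theorem HasWeakDeriv.ae_eq_zero {a b : ℝ} {u v : L2R} (hu : u ∈ supportedOn a b)
    (hv : HasWeakDeriv u v) : ∀ᵐ x : ℝ, x ∉ Icc a b → v x = 0 := by
  refine (isClosed_Icc.isOpen_compl).ae_eq_zero_of_integral_contDiff_smul_eq_zero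
    (((Lp.memLp v).locallyIntegrable (by norm_num)).locallyIntegrableOn _) fun φ h1 h2 h3 => ?_
  have h4 := hv φ h1 h2
  have h5 : ∫ x, u x * deriv φ x = 0 := by
    refine integral_eq_zero_of_ae ?_
    have hz : ∀ᵐ x : ℝ, x ∉ Ioo a b → u x = 0 := hu
    filter_upwards [hz] with x hx
    by_cases hxI : x ∈ Ioo a b
    · have : x ∉ tsupport φ := fun h => h3 h (Ioo_subset_Icc_self hxI)
      have : deriv φ x = 0 := by
        by_contra hne
        exact this (support_deriv_subset hne)
      simp [this]
    · simp [hx hxI]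
  rw [h5] at h4
  simp only [smul_eq_mul, mul_comm (φ _)]
  linarith

theorem HasWeakDeriv.integrable {a b : ℝ} {u v : L2R} (hu : u ∈ supportedOn a b)
    (hv : HasWeakDeriv u v) : Integrable v := by
  have hI : IntegrableOn v (Icc a b) :=
    ((Lp.memLp v).restrict (Icc a b)).integrable (by norm_num)
  refine (hI.integrable_indicator measurableSet_Icc).congr ?_
  filter_upwards [hv.ae_eq_zero hu] with x hx
  by_cases h : x ∈ Icc a b
  · simp [h]
  · simp [h, hx h]

/-- Testing the weak derivative with `y ↦ ∫₀ʰ φ(y - s) ds` gives the fundamental theorem of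
calculus for each fixed increment. -/
theorem HasWeakDeriv.ae_shift_sub {a b : ℝ} {u v : L2R} (hu : u ∈ supportedOn a b)
    (hv : HasWeakDeriv u v) {h : ℝ} (hh : 0 < h) :
    ∀ᵐ x : ℝ, u (x + h) - u x = ∫ s in Ioc 0 h, v (x + s) := by
  have hui := (integrable_and_integral_abs_le hu).1
  have hvi := hv.integrable hu
  have hi : Integrable fun x => ∫ s in Ioc 0 h, v (x + s) := by
    have := integrable_mul_setIntegral_shift hvi (ψ := fun _ => 1) (k := fun _ => 1)
      continuous_const (B := 1) (by simp) continuous_const h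
    simpa using this
  refine ae_eq_of_integral_contDiff_smul_eq
    (((hui.comp_add_right h).sub hui).locallyIntegrable) hi.locallyIntegrable fun φ h1 h2 => ?_
  obtain ⟨B, hB⟩ := exists_abs_le_of_hasCompactSupport h1.continuous h2
  obtain ⟨h3, h4⟩ := contDiff_windowIntegral h1 hh
  have h5 := hv _ h3 (hasCompactSupport_windowIntegral h2 h)
  have h6 := integral_mul_setIntegral_shift hvi h1.continuous hB (k := fun _ => 1)
    continuous_const h
  simp only [one_mul] at h6
  simp only [smul_eq_mul]
  rw [h6]
  simp only [h4] at h5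
  have i1 : Integrable fun x => φ x * u (x + h) :=
    (hui.comp_add_right h).bdd_mul h1.continuous.aestronglyMeasurable (Eventually.of_forall hB)
  have i2 : Integrable fun x => φ x * u x :=
    hui.bdd_mul h1.continuous.aestronglyMeasurable (Eventually.of_forall hB)
  have i3 : Integrable fun x => φ (x - h) * u x :=
    hui.bdd_mul (h1.continuous.comp (continuous_id.sub continuous_const)).aestronglyMeasurable
      (Eventually.of_forall fun x => hB _)
  have e1 : ∫ x, φ x * u (x + h) = ∫ x, φ (x - h) * u x := by
    rw [← integral_sub_right_eq_self (fun x => φ x * u (x + h)) h]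
    simp only [sub_add_cancel]
  have e2 : ∫ x, u x * (φ x - φ (x - h)) = (∫ x, φ x * u x) - ∫ x, φ (x - h) * u x := by
    rw [← integral_sub i2 i3]
    congr 1
    ext x
    ring
  have e3 : ∫ x, φ x * (u (x + h) - u x) = (∫ x, φ x * u (x + h)) - ∫ x, φ x * u x := by
    rw [← integral_sub i1 i2]
    congr 1
    ext x
    ring
  change ∫ x, φ x * (u (x + h) - u x) = _
  rw [e3, e1]
  linarith

theorem ae_eq_const_of_shift_invariant {g : ℝ → ℝ} (hg : Measurable g)
    (h : ∀ t : ℝ, 0 < t → ∀ᵐ x : ℝ, g (x + t) = g x) : ∃ c, ∀ᵐ x : ℝ, g x = c := by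
  have h' : ∀ t : ℝ, ∀ᵐ x : ℝ, g (x + t) = g x := by
    intro t
    rcases lt_trichotomy t 0 with ht | rfl | ht
    · have := (measurePreserving_add_right volume t).quasiMeasurePreserving.ae
        (h (-t) (by linarith))
      filter_upwards [this] with x hx
      rw [← hx, add_neg_cancel_right]
    · simp
    · exact h t ht
  have hm : MeasurableSet {p : ℝ × ℝ | g (p.2 + p.1) = g p.2} :=
    measurableSet_eq_fun (hg.comp (measurable_snd.add measurable_fst)) (hg.comp measurable_snd)
  have h2 : ∀ᵐ x : ℝ, ∀ᵐ t : ℝ, g (x + t) = g x :=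
    (Measure.ae_ae_comm (p := fun t x => g (x + t) = g x) hm).1 (Eventually.of_forall h')
  obtain ⟨x, hx⟩ := h2.exists
  refine ⟨g x, ?_⟩
  have := (measurePreserving_add_left volume (-x)).quasiMeasurePreserving.ae hx
  filter_upwards [this] with y hy
  rw [← hy, add_neg_cancel_left]

theorem HasWeakDeriv.exists_continuous_representative {a b : ℝ} {u v : L2R}
    (hu : u ∈ supportedOn a b) (hv : HasWeakDeriv u v) :
    ∃ U : ℝ → ℝ, Continuous U ∧ HasCompactSupport U ∧ u =ᵐ[volume] U ∧
      ∀ y z, U z - U y = ∫ s in y..z, v s := by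
  have hvi := hv.integrable hu
  set V : ℝ → ℝ := fun y => ∫ s in (0 : ℝ)..y, v s with hV
  have hVc : Continuous V :=
    intervalIntegral.continuous_primitive (fun _ _ => hvi.intervalIntegrable) 0
  have hVs : ∀ y z, V z - V y = ∫ s in y..z, v s := fun y z =>
    intervalIntegral.integral_interval_sub_left hvi.intervalIntegrable hvi.intervalIntegrable
  obtain ⟨c, hc⟩ := ae_eq_const_of_shift_invariant (g := fun x => u x - V x)
    ((Lp.stronglyMeasurable u).measurable.sub hVc.measurable) fun t ht => by
      filter_upwards [hv.ae_shift_sub hu ht] with x hx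
      rw [setIntegral_Ioc_comp_add_left ht, ← hVs] at hx
      linarith
  have hUc : Continuous fun y => c + V y := by fun_prop
  have hUu : u =ᵐ[volume] fun y => c + V y := by
    filter_upwards [hc] with x hx
    linarith
  refine ⟨fun y => c + V y, hUc, ?_, hUu, fun y z => by simp only [← hVs]; ring⟩
  refine HasCompactSupport.intro (K := Icc a b) isCompact_Icc fun x hx => ?_
  refine Measure.eqOn_open_of_ae_eq (μ := volume) (U := (Icc a b)ᶜ) (g := fun _ => 0) ?_
    isClosed_Icc.isOpen_compl hUc.continuousOn continuousOn_const hx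
  refine (ae_restrict_iff' measurableSet_Icc.compl).2 ?_
  have hz : ∀ᵐ x : ℝ, x ∉ Ioo a b → u x = 0 := hu
  filter_upwards [hz, hUu] with x h1 h2 h3
  rw [← h2]
  exact h1 fun h => h3 (Ioo_subset_Icc_self h)

/-! ### The upper bound for the energy of a fixed `H¹` function -/

theorem sq_setIntegral_le {v : ℝ → ℝ} {s : Set ℝ} (hs : volume s ≠ ⊤) (hv : IntegrableOn v s)
    (hv2 : IntegrableOn (fun r => v r ^ 2) s) :
    (∫ r in s, v r) ^ 2 ≤ volume.real s * ∫ r in s, v r ^ 2 := by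
  have : IsFiniteMeasure (volume.restrict s) := ⟨by simpa using hs.lt_top⟩
  set J := ∫ r in s, v r
  set m := volume.real s
  have h0 : 0 ≤ ∫ r in s, (m * v r - J) ^ 2 := integral_nonneg fun r => sq_nonneg _
  have i1 : IntegrableOn (fun r => m ^ 2 * v r ^ 2) s := hv2.const_mul _
  have i2 : IntegrableOn (fun r => 2 * m * J * v r) s := hv.const_mul _
  have i3 : IntegrableOn (fun _ : ℝ => J ^ 2) s := integrableOn_const hs
  have i12 : IntegrableOn (fun r => m ^ 2 * v r ^ 2 - 2 * m * J * v r) s := i1.sub i2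
  have e : ∫ r in s, (m * v r - J) ^ 2 = m * (m * (∫ r in s, v r ^ 2) - J ^ 2) := by
    have : ∀ r, (m * v r - J) ^ 2 = m ^ 2 * v r ^ 2 - 2 * m * J * v r + J ^ 2 := fun r => by ring
    simp only [this]
    rw [integral_add i12 i3, integral_sub i1 i2, integral_const_mul, integral_const_mul,
      setIntegral_const, smul_eq_mul]
    ring
  have hm0 : 0 ≤ m := measureReal_nonneg
  rcases hm0.eq_or_lt with hm | hm
  · have : volume s = 0 := by
      rcases (measureReal_eq_zero_iff hs).1 hm.symm with h
      exact h
    have hJ : J = 0 := setIntegral_measure_zero _ this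
    simp [hJ, ← hm]
  · rw [e] at h0
    have := nonneg_of_mul_nonneg_right h0 hm
    linarith

section UpperBound

variable {f U v : ℝ → ℝ} (hf : ContDiff ℝ 2 f) (hf2 : ∀ t, 0 ≤ deriv (deriv f) t)
  (hU : Continuous U) (hv : Integrable v) (hv2 : Integrable fun r => v r ^ 2)
  (hUv : ∀ y z, U z - U y = ∫ s in y..z, v s) {ε δ : ℝ}
  (hδ : ∀ x y, |x - y| < δ → |deriv (deriv f) (U x) - deriv (deriv f) (U y)| < ε)
  (hF : Integrable fun r => (deriv (deriv f) (U r) + ε) * v r ^ 2)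

include hf hf2 hU hv hv2 hUv hδ hF

/-- Taylor's formula, the intermediate value theorem and the Cauchy–Schwarz inequality bound the
Bregman divergence between two nearby values of `U`. -/
theorem bregman_le_setIntegral {m s : ℝ} (hms : |s - m| < δ) :
    bregman f (U s) (U m) ≤
      |s - m| / 2 * ∫ r in uIoc m s, (deriv (deriv f) (U r) + ε) * v r ^ 2 := by
  obtain ⟨c, hc, h⟩ := exists_bregman_eq hf (U s) (U m)
  obtain ⟨ξ, hξ, rfl⟩ := intermediate_value_uIcc hU.continuousOn hc
  have hvol : volume.real (uIoc m s) = |s - m| := by simp [measureReal_def, abs_nonneg]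
  have h1 : (U s - U m) ^ 2 ≤ |s - m| * ∫ r in uIoc m s, v r ^ 2 := by
    rw [hUv, ← sq_abs, intervalIntegral.abs_intervalIntegral_eq, sq_abs, ← hvol]
    exact sq_setIntegral_le (by simp) hv.integrableOn hv2.integrableOn
  have h2 : deriv (deriv f) (U ξ) * ∫ r in uIoc m s, v r ^ 2 ≤
      ∫ r in uIoc m s, (deriv (deriv f) (U r) + ε) * v r ^ 2 := by
    rw [← integral_const_mul]
    refine setIntegral_mono_on (hv2.integrableOn.const_mul _) hF.integrableOn
      measurableSet_uIoc fun r hr => ?_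
    have h3 : |ξ - r| < δ := (abs_sub_le_of_uIcc_subset_uIcc
      (uIcc_subset_uIcc (uIoc_subset_uIcc hr) hξ)).trans_lt hms
    have h4 := (abs_lt.1 (hδ ξ r h3)).2
    gcongr
    linarith
  rw [h]
  have h5 := hf2 (U ξ)
  calc deriv (deriv f) (U ξ) / 2 * (U s - U m) ^ 2
      ≤ deriv (deriv f) (U ξ) / 2 * (|s - m| * ∫ r in uIoc m s, v r ^ 2) := by gcongr
    _ = |s - m| / 2 * (deriv (deriv f) (U ξ) * ∫ r in uIoc m s, v r ^ 2) := by ring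
    _ ≤ _ := by gcongr

theorem integral_bregman_shift_le (hUc : HasCompactSupport U) {τ : ℝ} (hτ : |τ| < δ) :
    ∫ x, bregman f (U (x + τ)) (U x) ≤
      τ ^ 2 / 2 * ∫ r, (deriv (deriv f) (U r) + ε) * v r ^ 2 := by
  have hbc : Continuous fun p : ℝ × ℝ => bregman f p.1 p.2 := by
    have h1 := hf.continuous
    have h2 : Continuous (deriv f) := hf.continuous_deriv (by norm_num)
    unfold bregman
    fun_prop
  have hint : ∀ σ : ℝ, Integrable fun x => bregman f (U (x + σ)) (U x) := by
    intro σ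
    refine Continuous.integrable_of_hasCompactSupport
      (hbc.comp ((hU.comp (by fun_prop)).prodMk hU)) ?_
    have h1 : HasCompactSupport fun x => U (x + σ) :=
      hUc.comp_homeomorph (Homeomorph.addRight σ)
    refine (h1.isCompact.union hUc.isCompact).of_isClosed_subset (isClosed_tsupport _)
      (closure_minimal (fun x hx => ?_) ((isClosed_tsupport _).union (isClosed_tsupport _)))
    by_contra hne
    rw [mem_union, not_or] at hne
    apply hx
    simp [image_eq_zero_of_notMem_tsupport hne.2,
      image_eq_zero_of_notMem_tsupport (f := fun x => U (x + σ)) hne.1, bregman]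
  have key : ∀ σ : ℝ, 0 < σ → ∀ x, (σ / 2) * ∫ r in uIoc x (x + σ),
      (deriv (deriv f) (U r) + ε) * v r ^ 2 =
      σ ^ 2 / 2 * windowMean σ (fun r => (deriv (deriv f) (U r) + ε) * v r ^ 2) x := by
    intro σ hσ x
    rw [windowMean, setIntegral_Ioc_comp_add_left hσ
      (fun r => (deriv (deriv f) (U r) + ε) * v r ^ 2) x,
      intervalIntegral.integral_of_le (by linarith), uIoc_of_le (by linarith)]
    field_simp
  rcases lt_trichotomy τ 0 with h | rfl | h
  · have h1 : ∫ x, bregman f (U (x + τ)) (U x) = ∫ x, bregman f (U x) (U (x + -τ)) := by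
      rw [← integral_add_right_eq_self (fun x => bregman f (U (x + τ)) (U x)) (-τ)]
      simp
    have h2 : Integrable fun x => bregman f (U x) (U (x + -τ)) := by
      have := (hint τ).comp_add_right (-τ)
      simpa using this
    rw [h1, ← neg_sq τ, ← integral_windowMean hF (neg_pos.2 h), ← integral_const_mul]
    refine integral_mono h2 ((integrable_windowMean hF _).const_mul _) fun x => ?_
    have h3 := bregman_le_setIntegral hf hf2 hU hv hv2 hUv hδ hF (m := x + -τ) (s := x)
      (by simpa using hτ)
    rw [uIoc_comm, show |x - (x + -τ)| = -τ by simp [abs_of_neg h], key _ (neg_pos.2 h)] at h3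
    exact h3
  · simp [bregman]
  · rw [← integral_windowMean hF h, ← integral_const_mul]
    refine integral_mono (hint τ) ((integrable_windowMean hF _).const_mul _) fun x => ?_
    have h3 := bregman_le_setIntegral hf hf2 hU hv hv2 hUv hδ hF (m := x) (s := x + τ)
      (by simpa using hτ)
    rw [show |x + τ - x| = τ by simp [abs_of_pos h], key _ h] at h3
    exact h3

/-- Comparing the Jensen gap with the tangent of `f` at the value of `U` at the midpoint of the
window produces the sharp constant, since the mean of `(t - h / 2)² / 2` over `(0, h)` is
`h² / 24`. -/
theorem integral_gap_le (hUc : HasCompactSupport U) (hf0 : f 0 = 0) {h : ℝ} (hh : 0 < h)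
    (hhδ : h < δ) :
    ∫ x, (windowMean h (fun y => f (U y)) x - f (windowMean h U x)) ≤
      h ^ 2 / 24 * ∫ r, (deriv (deriv f) (U r) + ε) * v r ^ 2 := by
  set F := ∫ r, (deriv (deriv f) (U r) + ε) * v r ^ 2
  have hUi : Integrable U := hU.integrable_of_hasCompactSupport hUc
  have hfc := hf.continuous
  have hf1 : Continuous (deriv f) := hf.continuous_deriv (by norm_num)
  have hfUc : HasCompactSupport fun x => f (U x) := hUc.comp_left hf0
  have hfU : Integrable fun x => f (U x) :=
    (hfc.comp hU).integrable_of_hasCompactSupport hfUc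
  set p : ℝ → ℝ := fun x => U (x + h / 2) with hp
  have hpc : Continuous p := hU.comp (by fun_prop)
  have hpi : Integrable p := hUi.comp_add_right _
  obtain ⟨B, hB⟩ := exists_abs_le_of_hasCompactSupport hU hUc
  obtain ⟨C, hC⟩ : ∃ C, ∀ x, |deriv f (p x)| ≤ C := by
    obtain ⟨C, hC⟩ := (isCompact_Icc (a := -B) (b := B)).exists_bound_of_continuousOn
      hf1.continuousOn
    exact ⟨C, fun x => hC _ (abs_le.1 (hB _))⟩
  -- integrability of the Bregman divergences on the strip `ℝ × (0, h]`
  have hprod : Integrable (fun z : ℝ × ℝ => bregman f (U (z.1 + z.2)) (p z.1))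
      (volume.prod (volume.restrict (Ioc 0 h))) := by
    have j1 := integrable_shift_kernel hfU (ψ := fun _ => 1) (k := fun _ => 1)
      continuous_const (B := 1) (by simp) continuous_const h
    have j2 := integrable_shift_kernel hUi (ψ := fun x => deriv f (p x)) (k := fun _ => 1)
      (hf1.comp hpc) hC continuous_const h
    have j3 : Integrable (fun x => f (p x)) := hfU.comp_add_right (h / 2)
    have j4 : Integrable (fun x => deriv f (p x) * p x) :=
      hpi.bdd_mul (hf1.comp hpc).aestronglyMeasurable (Eventually.of_forall hC)
    refine (((j1.sub (j3.comp_fst (volume.restrict (Ioc 0 h)))).sub j2).add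
      (j4.comp_fst (volume.restrict (Ioc 0 h)))).congr (Eventually.of_forall fun z => ?_)
    simp [bregman]
    ring
  have hgap : ∀ x, windowMean h (fun y => f (U y)) x - f (windowMean h U x) ≤
      h⁻¹ * ∫ t in Ioc 0 h, bregman f (U (x + t)) (p x) := by
    intro x
    have i1 : IntegrableOn (fun t => f (U (x + t))) (Ioc 0 h) := integrableOn_shift hfU x _
    have i2 : IntegrableOn (fun _ : ℝ => f (p x)) (Ioc 0 h) := integrableOn_const (by simp)
    have i3 : IntegrableOn (fun t => U (x + t)) (Ioc 0 h) := integrableOn_shift hUi x _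
    have i4 : IntegrableOn (fun _ : ℝ => p x) (Ioc 0 h) := integrableOn_const (by simp)
    have i12 : IntegrableOn (fun t => f (U (x + t)) - f (p x)) (Ioc 0 h) := i1.sub i2
    have i34 : IntegrableOn (fun t => U (x + t) - p x) (Ioc 0 h) := i3.sub i4
    have e : h⁻¹ * ∫ t in Ioc 0 h, bregman f (U (x + t)) (p x) =
        windowMean h (fun y => f (U y)) x - f (p x) - deriv f (p x) * (windowMean h U x - p x) := by
      simp only [bregman]
      rw [integral_sub i12 (i34.const_mul _), integral_const_mul, integral_sub i1 i2,
        integral_sub i3 i4]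
      simp only [setIntegral_const, measureReal_def, Real.volume_Ioc, sub_zero,
        ENNReal.toReal_ofReal hh.le, smul_eq_mul, windowMean]
      field_simp
    have h1 := bregman_nonneg hf hf2 (windowMean h U x) (p x)
    rw [bregman] at h1
    rw [e]
    linarith
  have hg : Integrable fun x => windowMean h (fun y => f (U y)) x - f (windowMean h U x) := by
    refine (integrable_windowMean hfU h).sub (Continuous.integrable_of_hasCompactSupport
      (hfc.comp (continuous_windowMean hUi hh)) ?_)
    obtain ⟨R, hR⟩ := hUc.isCompact.isBounded.subset_closedBall 0
    refine HasCompactSupport.intro (K := Icc (-R - 1 - h) (R + 1)) isCompact_Icc fun x hx => ?_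
    rw [windowMean_eq_zero (Eventually.of_forall fun y hy => ?_) hx, hf0]
    by_contra hne
    have := hR (subset_tsupport U hne)
    rw [mem_closedBall_zero_iff, Real.norm_eq_abs, abs_le] at this
    exact hy ⟨by linarith [this.1], by linarith [this.2]⟩
  calc ∫ x, (windowMean h (fun y => f (U y)) x - f (windowMean h U x))
      ≤ ∫ x, h⁻¹ * ∫ t in Ioc 0 h, bregman f (U (x + t)) (p x) :=
        integral_mono hg (hprod.integral_prod_left.const_mul _) hgap
    _ = h⁻¹ * ∫ t in Ioc 0 h, ∫ x, bregman f (U (x + t)) (p x) := by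
        rw [integral_const_mul, integral_integral_swap hprod]
    _ ≤ h⁻¹ * ∫ t in Ioc 0 h, (t - h / 2) ^ 2 / 2 * F := by
        refine mul_le_mul_of_nonneg_left ?_ (inv_nonneg.2 hh.le)
        refine setIntegral_mono_on hprod.integral_prod_right
          ((Continuous.integrableOn_Icc (f := fun t => (t - h / 2) ^ 2 / 2 * F)
            (by fun_prop)).mono_set Ioc_subset_Icc_self)
          measurableSet_Ioc fun t ht => ?_
        have h1 : ∫ x, bregman f (U (x + t)) (p x) =
            ∫ x, bregman f (U (x + (t - h / 2))) (U x) := by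
          rw [← integral_add_right_eq_self
            (fun x => bregman f (U (x + (t - h / 2))) (U x)) (h / 2)]
          congr 1
          ext x
          rw [hp, add_add_sub_cancel]
        rw [h1]
        refine integral_bregman_shift_le hf hf2 hU hv hv2 hUv hδ hF hUc ?_
        rw [abs_lt]
        constructor <;> linarith [ht.1, ht.2]
    _ = _ := by
        rw [integral_mul_const, integral_div, setIntegral_Ioc_sub_half_sq hh]
        field_simp
        ring

end UpperBound

/-- The constant family is a recovery family: `f''` of the continuous representative is uniformly
continuous, so `integral_gap_le` applies with every `ε > 0` and `h` small. -/
theorem limsup_energy_le {f : ℝ → ℝ} (hf : ContDiff ℝ 2 f) (hf0 : f 0 = 0)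
    (hf2 : ∀ t, 0 ≤ deriv (deriv f) t) {a b : ℝ} {u : L2R} (hu : u ∈ supportedOn a b) :
    limsup (fun h => energy f h u) (𝓝[>] 0) ≤ limitEnergy f a b u := by
  by_cases hH1 : MemH1 u
  swap
  · rw [limitEnergy, dif_neg fun h => hH1 h.2]
    exact le_top
  set v := weakDeriv u hH1
  have hv : HasWeakDeriv u v := hH1.choose_spec
  obtain ⟨U, hU, hUc, hUu, hUv⟩ := hv.exists_continuous_representative hu
  have hvi := hv.integrable hu
  have hv2 : Integrable fun r => v r ^ 2 := (Lp.memLp v).integrable_sq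
  have hf2c := continuous_deriv_deriv hf
  have hfc := hf.continuous
  have hcomp : Continuous fun x => deriv (deriv f) (U x) := hf2c.comp hU
  have hFi : Integrable fun r => deriv (deriv f) (U r) * v r ^ 2 := by
    obtain ⟨B, hB⟩ := exists_abs_le_of_hasCompactSupport hU hUc
    obtain ⟨C, hC⟩ := (isCompact_Icc (a := -B) (b := B)).exists_bound_of_continuousOn
      hf2c.continuousOn
    exact hv2.bdd_mul hcomp.aestronglyMeasurable
      (Eventually.of_forall fun x => hC _ (abs_le.1 (hB x)))
  have hE0 : limitEnergy f a b u =
      ((1 / 24 * ∫ r, deriv (deriv f) (U r) * v r ^ 2 : ℝ) : EReal) := by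
    have hae : ∀ᵐ r, deriv (deriv f) (U r) * v r ^ 2 = deriv (deriv f) (u r) * v r ^ 2 := by
      filter_upwards [hUu] with r hr
      rw [hr]
    rw [limitEnergy, dif_pos ⟨hu, hH1⟩]
    simp only [sq_abs]
    rw [extIntegral_eq_integral (hFi.congr hae), integral_congr_ae hae, EReal.coe_mul]
  rw [hE0]
  set c := 1 / 24 * ∫ r, deriv (deriv f) (U r) * v r ^ 2 with hc
  have huc : UniformContinuous fun x => deriv (deriv f) (U x) := by
    have h1 : HasCompactSupport fun x => deriv (deriv f) (U x) - deriv (deriv f) 0 := by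
      refine hUc.mono fun x hx => ?_
      contrapose! hx
      simp [Function.notMem_support.1 hx]
    have h2 := h1.uniformContinuous_of_continuous (hcomp.sub continuous_const)
    simpa using h2.add_const (deriv (deriv f) 0)
  set D := ∫ r, v r ^ 2 with hD
  have hD0 : 0 ≤ D := integral_nonneg fun r => sq_nonneg _
  have hbound : ∀ ε : ℝ, 0 < ε →
      limsup (fun h => energy f h u) (𝓝[>] 0) ≤ ((c + ε * D : ℝ) : EReal) := by
    intro ε hε
    obtain ⟨δ, hδ0, hδ⟩ := Metric.uniformContinuous_iff.1 huc ε hε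
    refine limsup_le_of_le (by isBoundedDefault) ?_
    filter_upwards [Ioo_mem_nhdsGT hδ0] with h hh
    have hfu : Integrable fun x => f (u x) := by
      refine ((hfc.comp hU).integrable_of_hasCompactSupport (hUc.comp_left hf0)).congr ?_
      filter_upwards [hUu] with x hx
      simp [hx]
    have hFε : Integrable fun r => (deriv (deriv f) (U r) + ε) * v r ^ 2 := by
      refine (hFi.add (hv2.const_mul ε)).congr (Eventually.of_forall fun r => ?_)
      simp only [Pi.add_apply]
      ring
    have hgap := integral_gap_le hf hf2 hU hvi hv2 hUv (fun x y hxy => hδ hxy) hFε hUc hf0 hh.1 hh.2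
    have hw1 : windowMean h u = windowMean h U := windowMean_congr_ae h hUu
    have hw2 : windowMean h (fun y => f (u y)) = windowMean h (fun y => f (U y)) :=
      windowMean_congr_ae h (by filter_upwards [hUu] with x hx; rw [hx])
    rw [(energy_eq_integral_gap hfc hf0 hh.1 hu hfu).2, hw1, hw2, EReal.coe_le_coe_iff]
    have hsplit : ∫ r, (deriv (deriv f) (U r) + ε) * v r ^ 2 =
        (∫ r, deriv (deriv f) (U r) * v r ^ 2) + ε * D := by
      rw [hD, ← integral_const_mul, ← integral_add hFi (hv2.const_mul ε)]
      congr 1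
      ext r
      ring
    rw [hsplit] at hgap
    have hpos : 0 < h ^ 2 := pow_pos hh.1 2
    rw [inv_mul_le_iff₀ hpos]
    refine hgap.trans ?_
    have : 0 ≤ h ^ 2 * (ε * D) := by positivity
    rw [hc]
    linarith
  refine le_of_forall_gt fun M hM => ?_
  obtain ⟨M', h1, h2⟩ := EReal.lt_iff_exists_real_btwn.1 hM
  have h3 : c < M' := EReal.coe_lt_coe_iff.1 h1
  refine lt_of_le_of_lt (hbound ((M' - c) / (D + 1)) (div_pos (by linarith) (by linarith))) ?_
  refine lt_of_le_of_lt (EReal.coe_le_coe_iff.2 ?_) h2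
  have h4 : (M' - c) / (D + 1) * D ≤ M' - c := by
    rw [div_mul_eq_mul_div, div_le_iff₀ (by linarith)]
    nlinarith
  linarith

end FiniteDifference

end

theorem mainTheorem2 (f : ℝ → ℝ) (hf_nonneg : ∀ t, 0 ≤ f t) (hf : ContDiff ℝ 2 f)
    (hf0 : f 0 = 0) (hf0' : deriv f 0 = 0)
    (hf_conv : ∃ γ : ℝ, 0 < γ ∧ ∀ t, γ ≤ deriv (deriv f) t)
    (a b : ℝ) (hab : a < b)
    (u : FiniteDifference.L2R) (hu : u ∈ FiniteDifference.supportedOn a b) :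
    (∀ v : ℝ → FiniteDifference.L2R,
      (∀ h, 0 < h → v h ∈ FiniteDifference.supportedOn a b) →
      Tendsto v (𝓝[>] 0) (𝓝 u) →
      FiniteDifference.limitEnergy f a b u ≤
        liminf (fun h => FiniteDifference.energy f h (v h)) (𝓝[>] 0)) ∧
    (∃ v : ℝ → FiniteDifference.L2R,
      (∀ h, 0 < h → v h ∈ FiniteDifference.supportedOn a b) ∧
      Tendsto v (𝓝[>] 0) (𝓝 u) ∧
      limsup (fun h => FiniteDifference.energy f h (v h)) (𝓝[>] 0) ≤
        FiniteDifference.limitEnergy f a b u) := by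
  obtain ⟨γ, hγ0, hγ⟩ := hf_conv
  refine ⟨fun v hv hvu => FiniteDifference.limitEnergy_le_liminf hf_nonneg hf hf0 hγ hγ0 hu hv hvu,
    fun _ => u, fun _ _ => hu, tendsto_const_nhds,
    FiniteDifference.limsup_energy_le hf hf0 (fun t => hγ0.le.trans (hγ t)) hu⟩
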